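/- Let $q$ be a power of a prime $p$, let $C$ be a nonsingular projective curve over $\mathbb{F}_q$, let $\infty$ be a closed point of $C$, and let $A$ be the ring of functions on $C$ that are regular everywhere except possibly at $\infty$. For a field $K$, let $M_K$ be the set of discrete valuations $v$ of $K$, normalized to have range $\mathbb{Z}$ on $K^\times$. A set $U\subseteq M_K$ with a function $d:U\to\mathbb{R}_{>0}$ is a \emph{good set of valuations} if for every nonzero $x\in K$ there are only finitely many $v\in U$ with $v(x)\neq 0$, and $\sum_{v\in U}d(v)\,v(x)=0$. Its \emph{field of constants} is $\{0\}\cup\{x\in K^\times : v(x)=0 \text{ for all } v\in U\}$. A valuation $v\in M_K$ is \emph{coherent} if $\sum_{w\in M_L,\,w\mid v}e(w|v)f(w|v)=[L:K]$ for every finite extension $L$ of $K$ inside a fixed algebraic closure $K^{\mathrm{alg}}$, where $e$ and $f$ are the ramification index and the residue degree. The good set $U$ is \emph{coherent} if every $v\in U$ is coherent and, for every such $L$, the set of all $w\in M_L$ lying over elements of $U$, with degrees $d(w)=f(w|v)d(v)/[L:K]$ for $w\mid v$, is a good set of valuations on $L$. Let $K$ be a field extension of $\mathbb{F}_q$, and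 let $K\{\tau\}$ be the ring of polynomials in the operator $\tau:x\mapsto x^q$, with multiplication given by composition. A \emph{Drinfeld module} is a ring homomorphism $\phi:A\to K\{\tau\}$, $a\mapsto\phi_a$, such that the coefficient of $\tau^0$ in $\phi_a$ is $i(a)$ for all $a\in A$, where $i:A\to K$ is a homomorphism of $\mathbb{F}_q$-algebras, and $\phi_a\ne i(a)\tau^0$ for some $a\in A$. Write $\phi(K)$ for $K$ with the $A$-module structure $a\cdot x=\phi_a(x)$. For $\gamma\in K^{\mathrm{alg}}\setminus\{0\}$ let $\phi^{(\gamma)}$ be the conjugate $a\mapsto\gamma^{-1}\phi_a\gamma$; its \emph{field of definition} is the smallest subfield of $K^{\mathrm{alg}}$ containing the coefficients of all $\phi^{(\gamma)}_a$, $a\in A$. The \emph{relative modular transcendence degree} of $\phi$ over a subfield $K_0$ of $K$ is the minimum over all $\gamma\in K^{\mathrm{alg}}\setminus\{0\}$ of the transcendence degree over $K_0$ of the compositum of $K_0$ and the field of definition of $\phi^{(\gamma)}$. \textbf{Theorem.} Let $K$ be a countable field extension of $\mathbb{F}_q$ (so of characteristic $p$), let $U$ be a coherent good set of valuations on $K$,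 and let $F$ be the field of constants of $U$. Let $\phi:A\to K\{\tau\}$ be a Drinfeld module of positive relative modular transcendence degree over $F$. Then $\phi(K)$ is the direct sum of a finite torsion $A$-submodule and a free $A$-submodule of rank $\aleph_0$. -/

import Mathlib

open scoped WithZero

noncomputable section

/-! ### Normalized discrete valuations -/

/-- A normalized discrete valuation of a field `K`: a valuation whose range on `Kˣ` is (all of)
`ℤ`, in Mathlib's multiplicative convention (`ℤᵐ⁰` is `ℤ` written multiplicatively, with a `0`
added). The type `DiscVal K` is the set `M_K` of all discrete valuations of `K`. -/
structure DiscVal (K : Type*) [Field K] where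
  /-- the underlying valuation -/
  val : Valuation K ℤᵐ⁰
  surj : Function.Surjective val

namespace DiscVal

variable {K L : Type*} [Field K] [Field L] [Algebra K L]

/-- The additive value `v(x) ∈ ℤ` of a nonzero `x` (with the junk value `0` at `x = 0`). -/
def ord (v : DiscVal K) (x : K) : ℤ := -WithZero.log (v.val x)

/-- `w ∣ v`: the restriction of `w` to `K` is equivalent to `v`. -/
abbrev LiesOver (w : DiscVal L) (v : DiscVal K) : Prop := v.val.HasExtension w.val

/-- The ramification index `e(w|v)`: the index in the value group of `w` (all of `ℤ`, since `w` is
normalized) of the value group of the restriction of `w` to `K`. -/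
def ramificationIndex (K : Type*) {L : Type*} [Field K] [Field L] [Algebra K L]
    (w : DiscVal L) : ℕ :=
  (Units.map (w.val.comap (algebraMap K L) : K →* ℤᵐ⁰)).range.index

/-- The relative degree `f(w|v)`: the degree of the residue field of `w` over the residue field
of `v`. -/
def relativeDegree {w : DiscVal L} {v : DiscVal K} (h : w.LiesOver v) : ℕ :=
  haveI : v.val.HasExtension w.val := h
  letI : Module (IsLocalRing.ResidueField v.val.valuationSubring)
    (IsLocalRing.ResidueField w.val.valuationSubring) := Algebra.toModule
  Module.finrank (IsLocalRing.ResidueField v.val.valuationSubring)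
    (IsLocalRing.ResidueField w.val.valuationSubring)

/-- `v` is defectless in the finite extension `L`: `∑_{w ∣ v} e(w|v) f(w|v) = [L : K]`. -/
def IsDefectlessIn (v : DiscVal K) (L : Type*) [Field L] [Algebra K L] : Prop :=
  ∑ᶠ w : {w : DiscVal L // w.LiesOver v}, ramificationIndex K w.1 * relativeDegree w.2
    = Module.finrank K L

/-- `v` is coherent (on the algebraic closure of `K`): it is defectless in every finite extension
of `K` inside the algebraic closure. -/
def IsCoherent (v : DiscVal K) : Prop :=
  ∀ L : IntermediateField K (AlgebraicClosure K), FiniteDimensional K L → v.IsDefectlessIn L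

end DiscVal

/-! ### Good sets of valuations -/

/-- `U ⊆ M_K`, with the degree function `d`, is a good set of valuations. -/
structure IsGoodSet {K : Type*} [Field K] (U : Set (DiscVal K)) (d : U → ℝ) : Prop where
  deg_pos : ∀ v, 0 < d v
  finite_support : ∀ x : K, x ≠ 0 → {v : U | v.1.ord x ≠ 0}.Finite
  sum_formula : ∀ x : K, x ≠ 0 → ∑ᶠ v : U, d v * (v.1.ord x : ℝ) = 0

/-- `U_L`: the valuations of `L` lying over valuations in `U`. -/
def extensionSet {K : Type*} [Field K] (U : Set (DiscVal K)) (L : Type*) [Field L] [Algebra K L] :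
    Set (DiscVal L) :=
  {w | ∃ v ∈ U, w.LiesOver v}

/-- The good set of valuations `U`, with degrees `d`, is coherent: for every finite extension `L`
the set `U_L`, with degrees `d(w) = f(w|v) d(v) / [L : K]` for `w ∣ v`, is a good set of valuations,
and every `v ∈ U` is a coherent valuation. -/
structure IsCoherentGoodSet {K : Type*} [Field K] (U : Set (DiscVal K)) (d : U → ℝ) : Prop where
  isGoodSet : IsGoodSet U d
  extension : ∀ L : IntermediateField K (AlgebraicClosure K), FiniteDimensional K L →
    ∃ dL : extensionSet U L → ℝ,
      (∀ (w : extensionSet U L) (v : U) (h : w.1.LiesOver v.1),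
        dL w = DiscVal.relativeDegree h * d v / Module.finrank K L) ∧
      IsGoodSet (extensionSet U L) dL
  isCoherent : ∀ v ∈ U, v.IsCoherent

namespace IsGoodSet

variable {K : Type*} [Field K] {U : Set (DiscVal K)} {d : U → ℝ}

/-- An element that is integral at every valuation of a good set is zero or a unit at all of
them. -/
lemma eq_one_of_le_one (h : IsGoodSet U d) {x : K} (hx : x ≠ 0)
    (hle : ∀ v ∈ U, v.val x ≤ 1) : ∀ v ∈ U, v.val x = 1 := by
  have hnn : ∀ v : U, 0 ≤ d v * (v.1.ord x : ℝ) := fun v => by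
    have h0 : v.1.val x ≠ 0 := (Valuation.ne_zero_iff _).2 hx
    have : WithZero.log (v.1.val x) ≤ WithZero.log (1 : ℤᵐ⁰) :=
      (WithZero.log_le_log h0 one_ne_zero).2 (hle v.1 v.2)
    have h1 : 0 ≤ v.1.ord x := by simpa [DiscVal.ord] using this
    exact mul_nonneg (h.deg_pos v).le (by exact_mod_cast h1)
  have hfin : (Function.support fun v : U => d v * (v.1.ord x : ℝ)).Finite :=
    (h.finite_support x hx).subset fun v hv => by
      intro h0
      exact hv (by simp [h0])
  intro v hv
  have hsum := h.sum_formula x hx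
  rw [finsum_eq_sum _ hfin] at hsum
  have hz : d ⟨v, hv⟩ * (v.ord x : ℝ) = 0 := by
    by_cases hm : (⟨v, hv⟩ : U) ∈ hfin.toFinset
    · exact (Finset.sum_eq_zero_iff_of_nonneg fun i _ => hnn i).1 hsum _ hm
    · by_contra hne
      exact hm (by simpa using hne)
  have hord : v.ord x = 0 := by
    rcases mul_eq_zero.1 hz with h' | h'
    · exact absurd h' (h.deg_pos _).ne'
    · exact_mod_cast h'
  have h0 : v.val x ≠ 0 := (Valuation.ne_zero_iff _).2 hx
  have hlog : WithZero.log (v.val x) = 0 := by simpa [DiscVal.ord] using hord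
  rw [← WithZero.exp_log h0, hlog, WithZero.exp_zero]

/-- The field of constants `C(U)` of a good set of valuations: `0` together with the `x` such that
`v(x) = 0` (multiplicatively, `v x = 1`) for all `v ∈ U`. -/
def constants (h : IsGoodSet U d) : Subfield K where
  carrier := {x | x = 0 ∨ ∀ v ∈ U, v.val x = 1}
  mul_mem' := by
    rintro x y (rfl | hx) (rfl | hy)
    · simp
    · simp
    · simp
    · exact Or.inr fun v hv => by simp [hx v hv, hy v hv]
  one_mem' := Or.inr fun v _ => by simp
  add_mem' := by
    rintro x y (rfl | hx) (rfl | hy)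
    · simp
    · exact Or.inr (by simpa using hy)
    · exact Or.inr (by simpa using hx)
    · by_cases hxy : x + y = 0
      · exact Or.inl hxy
      · exact Or.inr (h.eq_one_of_le_one hxy fun v hv =>
          (v.val.map_add x y).trans (by simp [hx v hv, hy v hv]))
  zero_mem' := Or.inl rfl
  neg_mem' := by
    rintro x (rfl | hx)
    · simp
    · exact Or.inr fun v hv => by simp [Valuation.map_neg, hx v hv]
  inv_mem' := by
    rintro x (rfl | hx)
    · simp
    · exact Or.inr fun v hv => by simp [hx v hv]

end IsGoodSet

/-! ### The ring `A` -/

/-- `A`: the ring of functions regular away from `∞` on the nonsingular projective curve over `𝔽_q`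
with function field `E`. The closed points of the curve are the normalized discrete valuations of
`E` (they are all trivial on the finite field `𝔽_q`), and a function is regular at a point if it
lies in the corresponding valuation ring. -/
def regularFunctions (Fq : Type*) {E : Type*} [Field Fq] [Finite Fq] [Field E] [Algebra Fq E]
    (infty : DiscVal E) : Subalgebra Fq E where
  carrier := {f | ∀ P : DiscVal E, P ≠ infty → P.val f ≤ 1}
  mul_mem' := fun hf hg P hP => by
    rw [map_mul]
    exact mul_le_one' (hf P hP) (hg P hP)
  add_mem' := fun hf hg P hP => (P.val.map_add _ _).trans (max_le (hf P hP) (hg P hP))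
  algebraMap_mem' := fun _ P _ => FiniteField.valuation_algebraMap_le_one _ _

/-! ### The ring `K{τ}` and Drinfeld modules -/

/-- The action of `ℕ` on `K` through the powers of the `q`-power Frobenius `x ↦ x ^ q`, where
`q` is the cardinality of `Fq`. -/
@[reducible] def frobeniusAction (Fq K : Type*) [Field Fq] [Finite Fq] [Field K] [Algebra Fq K] :
    MulSemiringAction (Multiplicative ℕ) K :=
  letI := Fintype.ofFinite Fq
  MulSemiringAction.compHom K
    (powersHom (K →+* K) (FiniteField.frobeniusAlgHom Fq K : K →+* K))

/-- `K{τ}`: the skew polynomials over `K` in the `q`-power Frobenius `τ` (so `τ a = a ^ q τ`),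
where `q` is the cardinality of `Fq`. -/
def TwistedPoly (Fq K : Type*) [Field Fq] [Finite Fq] [Field K] [Algebra Fq K] : Type _ :=
  SkewPolynomial K

namespace TwistedPoly

variable {Fq K : Type*} [Field Fq] [Finite Fq] [Field K] [Algebra Fq K]

instance : Ring (TwistedPoly Fq K) :=
  letI := frobeniusAction Fq K
  inferInstanceAs (Ring (SkewPolynomial K))

/-- The coefficient of `τ ^ n`. -/
def coeff (f : TwistedPoly Fq K) (n : ℕ) : K := SkewPolynomial.coeff f n

/-- The constant polynomial `c τ ^ 0`. -/
def const (c : K) : TwistedPoly Fq K := (SkewPolynomial.C c : SkewPolynomial K)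

/-- The value `f(x) = ∑ aₙ x ^ (q ^ n)` of `f = ∑ aₙ τ ^ n` at `x`. -/
def eval (f : TwistedPoly Fq K) (x : K) : K :=
  SkewPolynomial.sum (R := K) f fun n a => a * x ^ (Nat.card Fq ^ n)

lemma iterate_frobenius (n : ℕ) (x : K) :
    letI := Fintype.ofFinite Fq
    ((FiniteField.frobeniusAlgHom Fq K : K →+* K) ^ n) x = x ^ (Nat.card Fq ^ n) := by
  let := Fintype.ofFinite Fq
  rw [RingHom.coe_pow]
  change (⇑(FiniteField.frobeniusAlgHom Fq K))^[n] x = _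
  rw [FiniteField.coe_frobeniusAlgHom, pow_iterate, Nat.card_eq_fintype_card]

lemma frob_add (n : ℕ) (x y : K) :
    (x + y) ^ (Nat.card Fq ^ n) = x ^ (Nat.card Fq ^ n) + y ^ (Nat.card Fq ^ n) := by
  rw [← iterate_frobenius, ← iterate_frobenius, ← iterate_frobenius, map_add]

lemma frobeniusAction_smul (n : ℕ) (x : K) :
    letI := frobeniusAction Fq K
    Multiplicative.ofAdd n • x = x ^ (Nat.card Fq ^ n) :=
  iterate_frobenius n x

/-- The monomial `c τ ^ n`. -/
def monomial (n : ℕ) (c : K) : TwistedPoly Fq K := (SkewPolynomial.monomial n c : SkewPolynomial K)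

lemma eval_monomial (n : ℕ) (c x : K) :
    eval (monomial n c : TwistedPoly Fq K) x = c * x ^ (Nat.card Fq ^ n) :=
  SkewPolynomial.sum_monomial_index (R := K) (N := K) (h := fun n a => a * x ^ (Nat.card Fq ^ n))
    (zero_mul _)

lemma eval_add (f g : TwistedPoly Fq K) (x : K) : eval (f + g) x = eval f x + eval g x :=
  SkewMonoidAlgebra.sum_add_index' (fun _ => by simp) (fun _ _ _ => by ring)

lemma eval_zero (x : K) : eval (0 : TwistedPoly Fq K) x = 0 :=
  SkewMonoidAlgebra.sum_zero_index (k := K) (G := Multiplicative ℕ) (S := K)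
    (f := fun n a => a * x ^ (Nat.card Fq ^ Multiplicative.toAdd n))

lemma induction {motive : TwistedPoly Fq K → Prop} (f : TwistedPoly Fq K) (h0 : motive 0)
    (ha : ∀ (n : ℕ) (c : K) (g : TwistedPoly Fq K), motive g → motive (monomial n c + g)) :
    motive f :=
  SkewPolynomial.induction (motive := motive) f h0 fun n c g _ _ => ha n c g

lemma monomial_mul_monomial (m n : ℕ) (a b : K) :
    (monomial m a * monomial n b : TwistedPoly Fq K) =
      monomial (m + n) (a * b ^ (Nat.card Fq ^ m)) := by
  let := frobeniusAction Fq K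
  have h := SkewPolynomial.monomial_mul_monomial m n a b
  rw [SkewPolynomial.φ_iterate_apply, frobeniusAction_smul (Fq := Fq)] at h
  exact h

lemma eval_apply_zero (f : TwistedPoly Fq K) : eval f 0 = 0 := by
  induction f using TwistedPoly.induction with
  | h0 => exact eval_zero 0
  | ha n c g hg =>
    have : (Nat.card Fq ^ n) ≠ 0 := pow_ne_zero _ Nat.card_pos.ne'
    rw [eval_add, eval_monomial, hg, zero_pow this, mul_zero, add_zero]

lemma eval_apply_add (f : TwistedPoly Fq K) (x y : K) :
    eval f (x + y) = eval f x + eval f y := by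
  induction f using TwistedPoly.induction with
  | h0 => simp [eval_zero]
  | ha n c g hg =>
    rw [eval_add, eval_add, eval_add, eval_monomial, eval_monomial, eval_monomial, hg, frob_add]
    ring

lemma eval_one (x : K) : eval (1 : TwistedPoly Fq K) x = x := by
  have h : eval (monomial 0 1 : TwistedPoly Fq K) x = x := by simp [eval_monomial]
  exact h

lemma eval_mul (f g : TwistedPoly Fq K) (x : K) : eval (f * g) x = eval f (eval g x) := by
  induction f using TwistedPoly.induction with
  | h0 => rw [zero_mul, eval_zero, eval_zero]
  | ha m a f hf =>
    rw [add_mul, eval_add, eval_add, hf]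
    congr 1
    clear hf
    induction g using TwistedPoly.induction with
    | h0 => rw [mul_zero, eval_zero, eval_apply_zero]
    | ha n b g hg =>
      rw [mul_add, eval_add, eval_add, eval_apply_add, hg, monomial_mul_monomial]
      simp only [eval_monomial, mul_pow, ← pow_mul, pow_add]
      ring

end TwistedPoly

/-- A Drinfeld module `φ : A → K{τ}`: a ring homomorphism, together with a morphism `i : A → K` of
`𝔽_q`-algebras, such that the coefficient of `τ ^ 0` in `φ_a` is `i(a)` for all `a`, and
`φ_a ≠ i(a) τ ^ 0` for some `a`. -/
structure DrinfeldModule (Fq A K : Type*) [Field Fq] [Finite Fq] [CommRing A] [Algebra Fq A]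
    [Field K] [Algebra Fq K] where
  /-- the structure morphism `i` -/
  i : A →ₐ[Fq] K
  /-- the homomorphism `a ↦ φ_a` -/
  hom : A →+* TwistedPoly Fq K
  coeff_zero : ∀ a, (hom a).coeff 0 = i a
  nontrivial : ∃ a, hom a ≠ TwistedPoly.const (i a)

namespace DrinfeldModule

variable {Fq A K : Type*} [Field Fq] [Finite Fq] [CommRing A] [Algebra Fq A]
  [Field K] [Algebra Fq K]

/-- `φ(K)`: the additive group of `K`, with the `A`-action `a • x = φ_a(x)`. -/
def Points (_φ : DrinfeldModule Fq A K) : Type _ := K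

instance (φ : DrinfeldModule Fq A K) : AddCommGroup φ.Points :=
  inferInstanceAs (AddCommGroup K)

lemma eval_hom_one (φ : DrinfeldModule Fq A K) (x : K) : (φ.hom 1).eval x = x := by
  rw [map_one, TwistedPoly.eval_one]

lemma eval_hom_mul (φ : DrinfeldModule Fq A K) (a b : A) (x : K) :
    (φ.hom (a * b)).eval x = (φ.hom a).eval ((φ.hom b).eval x) := by
  rw [map_mul, TwistedPoly.eval_mul]

lemma eval_hom_add (φ : DrinfeldModule Fq A K) (a b : A) (x : K) :
    (φ.hom (a + b)).eval x = (φ.hom a).eval x + (φ.hom b).eval x := by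
  rw [map_add, TwistedPoly.eval_add]

lemma eval_hom_zero (φ : DrinfeldModule Fq A K) (x : K) : (φ.hom 0).eval x = 0 := by
  rw [map_zero, TwistedPoly.eval_zero]

instance (φ : DrinfeldModule Fq A K) : Module A φ.Points where
  smul a x := TwistedPoly.eval (K := K) (φ.hom a) x
  one_smul := φ.eval_hom_one
  mul_smul := φ.eval_hom_mul
  smul_zero a := TwistedPoly.eval_apply_zero (φ.hom a)
  smul_add a := TwistedPoly.eval_apply_add (φ.hom a)
  add_smul := φ.eval_hom_add
  zero_smul := φ.eval_hom_zero

/-- The field of definition of the conjugate `φ^(γ) : a ↦ γ⁻¹ φ_a γ`, for `γ` a nonzero element of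
the algebraic closure of `K`: the smallest subfield containing the coefficients of all `φ^(γ)_a`.
The coefficient of `τ ^ n` in `γ⁻¹ (∑ cₙ τ ^ n) γ` is `γ⁻¹ cₙ γ ^ (q ^ n)`. -/
def conjFieldOfDefinition (φ : DrinfeldModule Fq A K) (γ : AlgebraicClosure K) :
    Subfield (AlgebraicClosure K) :=
  Subfield.closure {c | ∃ (a : A) (n : ℕ),
    c = γ⁻¹ * algebraMap K (AlgebraicClosure K) ((φ.hom a).coeff n) * γ ^ (Nat.card Fq ^ n)}

/-- The relative modular transcendence degree of `φ` over the subfield `K₀` of `K`: the minimum,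
over the nonzero `γ` in the algebraic closure of `K`, of the transcendence degree over `K₀` of the
compositum of `K₀` and the field of definition of `φ^(γ)`. (An infimum of a nonempty family of
cardinals is a minimum.) -/
def relModularTrdeg (φ : DrinfeldModule Fq A K) (K₀ : Subfield K) : Cardinal :=
  ⨅ γ : {γ : AlgebraicClosure K // γ ≠ 0},
    Algebra.trdeg K₀ (IntermediateField.adjoin K₀
      (φ.conjFieldOfDefinition γ.1 : Set (AlgebraicClosure K)))

end DrinfeldModule

end

/-!
The idea is that of Poonen's analogue of the Mordell–Weil theorem: a height function controls the
module structure of `φ(K)`.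

*The height.* Choose `t ∈ A` such that `φ_t` has degree `D ≥ 2` in `τ`, and let `Q = q ^ D`. Over
a finite extension `L = K(γ)` the conjugate `T = γ⁻¹ φ_t γ` is monic. Let `V` be the good set of
valuations of `L` above `U`. Where the coefficients of `T` have absolute value at most `exp m_w`,
the *excess* of `y` at `w` is `log |y|_w` if this exceeds `m_w`, and `0` otherwise; `T` multiplies
a positive excess by `Q`. So Tate's limit `h(y) = lim Q⁻ⁿ ∑_w d(w) excess_w(Tⁿ y)` exists, is
subadditive, and satisfies `h(T y) = Q h(y)`.

*Finitely many points of small height.* If all coefficients of `T` were integral at all of `V`, they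
would be algebraic over the field of constants `F` (`IsGoodSet.isAlgebraic_constants`); since
`φ_a` commutes with `φ_t`, so would be all coefficients of `γ⁻¹ φ_a γ`
(`isAlgebraic_of_commute`), and the relative modular transcendence degree would vanish
(`DrinfeldModule.relModularTrdeg_eq_zero`). So there is a bad valuation, at which some coefficient
is not integral. At a bad valuation the points whose iterates under `T` stay in a bounded ball lie
in finitely many residue classes modulo the maximal ideal (`IsMonicAdditive.exists_finite_cover`).
Two points of small height in the same classes at all the bad valuations differ by an element `z` with
`|z| < 1` at these valuations and with little positive contribution at the others; the sum formula
forces `z = 0` (`exists_finite_canonicalHeight_lt`, `DrinfeldModule.exists_height`).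

*From heights to structure.* Let `𝔽_q[t]` act on `φ(K)` through `φ_t`. If `r x` lies in the span of
finitely many points for some nonzero `r`, expand the coefficients in powers of `t`: by pigeonhole
on the digits and by finiteness of the points of small height, all such `x` lie in one finitely
generated submodule (`IsHeight.exists_fg_hull`, `IsHeight.hasFGHulls`). Applied to `A x` for a
nontorsion point `x`, this shows that `A` is finite over `𝔽_q[t]`; as an intersection of
valuation rings `A` is integrally closed, hence a Dedekind domain. Over a Dedekind domain a
countable module whose finitely generated submodules have finitely generated hulls, and whose
torsion is finite, is the direct sum of its torsion and a free module of rank `ℵ₀`, unless it is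
finitely generated (`HasFGHulls.exists_isCompl_torsion`): the torsion-free quotient is an ascending
union of free submodules, each a direct summand in the next. Torsion points have height `0`, so they
are finite in number, and `φ(K)` is not finitely generated because `K / φ_t(K)` is infinite
(`DrinfeldModule.not_exists_finite_coset`), as the pole orders at any `v ∈ U` show.
-/

/-! ### Modules over a Dedekind domain in which finitely generated submodules have
finitely generated hulls -/

namespace Submodule

variable {R M : Type*} [CommRing R] [AddCommGroup M] [Module R M]

/-- A submodule `N` of `M` is saturated if `a • x ∈ N` with `a ≠ 0` forces `x ∈ N`; over a domain
this says that `M ⧸ N` is torsion-free. -/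
def IsSaturated (N : Submodule R M) : Prop :=
  ∀ (a : R) (x : M), a ≠ 0 → a • x ∈ N → x ∈ N

lemma IsSaturated.comap_mkQ {N : Submodule R M} {H : Submodule R (M ⧸ N)} (hH : H.IsSaturated) :
    (H.comap N.mkQ).IsSaturated := fun a x ha hx =>
  hH a _ ha (by simpa using hx)

lemma IsSaturated.isTorsionFree [IsDomain R] {N : Submodule R M} (hN : N.IsSaturated) :
    Module.IsTorsionFree R (M ⧸ N) := by
  refine Module.IsTorsionFree.of_smul_eq_zero fun a x hx => ?_
  by_contra! h
  obtain ⟨x, rfl⟩ := N.mkQ_surjective x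
  rw [← map_smul, mkQ_apply, Quotient.mk_eq_zero] at hx
  exact h.2 (by simpa using hN a x h.1 hx)

/-- A projective submodule of `M ⧸ G` lifts to a complement of `G` in its preimage. -/
lemma exists_lift_of_projective (G : Submodule R M) (H : Submodule R (M ⧸ G))
    [Module.Projective R H] :
    ∃ C : Submodule R M, Disjoint G C ∧ G ⊔ C = H.comap G.mkQ ∧ Nonempty (C ≃ₗ[R] H) := by
  obtain ⟨s, hs⟩ := Module.projective_lifting_property G.mkQ H.subtype G.mkQ_surjective
  have hs' : ∀ x, G.mkQ (s x) = x := fun x => congrArg (fun f => f x) hs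
  have hinj : Function.Injective s := fun x y hxy => Subtype.ext (by rw [← hs', hxy, hs'])
  refine ⟨LinearMap.range s, ?_, ?_, ⟨(LinearEquiv.ofInjective s hinj).symm⟩⟩
  · rw [disjoint_def]
    rintro _ hx ⟨y, rfl⟩
    have h0 : G.mkQ (s y) = 0 := by simpa using hx
    rw [hs'] at h0
    rw [show y = 0 from Subtype.ext h0, map_zero]
  · refine le_antisymm (sup_le (fun x hx => ?_) ?_) fun x hx => ?_
    · have : G.mkQ x = 0 := by simpa using hx
      rw [mem_comap, this]
      exact H.zero_mem
    · rintro _ ⟨y, rfl⟩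
      rw [mem_comap, hs']
      exact y.2
    · refine mem_sup.2 ⟨x - s ⟨G.mkQ x, hx⟩, ?_, s ⟨G.mkQ x, hx⟩, ⟨_, rfl⟩, by abel⟩
      rw [← Quotient.mk_eq_zero, ← mkQ_apply, map_sub, hs', sub_self]

/-- The sum of two disjoint submodules is their product. -/
lemma nonempty_prod_equiv_sup {G C : Submodule R M} (h : Disjoint G C) :
    Nonempty ((G × C) ≃ₗ[R] (G ⊔ C : Submodule R M)) := by
  have hinj : Function.Injective (G.subtype.coprod C.subtype) := by
    rw [← LinearMap.ker_eq_bot, LinearMap.ker_coprod_of_disjoint_range]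
    · simp
    · simpa using h
  exact ⟨(LinearEquiv.ofInjective _ hinj).trans
    (LinearEquiv.ofEq _ _ (by simp [LinearMap.range_coprod]))⟩

end Submodule

open Submodule

/-- `M` has finitely generated hulls if each finitely generated submodule of `M` is contained in a
finitely generated saturated one. For torsion-free `M` over a Noetherian domain: every submodule of
finite rank is finitely generated. Such modules are also called tame. -/
def HasFGHulls (R M : Type*) [CommRing R] [AddCommGroup M] [Module R M] : Prop :=
  ∀ P : Submodule R M, P.FG → ∃ Q : Submodule R M, P ≤ Q ∧ Q.FG ∧ Q.IsSaturated

lemma HasFGHulls.quotient {R M : Type*} [CommRing R] [AddCommGroup M] [Module R M]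
    (h : HasFGHulls R M) {N : Submodule R M} (hN : N.FG) : HasFGHulls R (M ⧸ N) := by
  intro P hP
  obtain ⟨P', hP', rfl⟩ : ∃ P' : Submodule R M, P'.FG ∧ P'.map N.mkQ = P := by
    obtain ⟨s, rfl⟩ := hP
    classical
    refine ⟨span R (s.image (Function.surjInv N.mkQ_surjective)), ⟨_, rfl⟩, ?_⟩
    rw [map_span]
    congr 1
    rw [Finset.coe_image, Set.image_image]
    simp only [Function.surjInv_eq N.mkQ_surjective, Set.image_id']
  obtain ⟨Q, hQ, hQfg, hQs⟩ := h _ (hP'.sup hN)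
  refine ⟨Q.map N.mkQ, map_mono (le_sup_left.trans hQ), hQfg.map _, fun a x ha hx => ?_⟩
  obtain ⟨x, rfl⟩ := N.mkQ_surjective x
  obtain ⟨y, hy, hyx⟩ := hx
  rw [← map_smul, ← sub_eq_zero, ← map_sub, mkQ_apply, Quotient.mk_eq_zero] at hyx
  have : a • x ∈ Q := by
    have := Q.sub_mem hy (hQ (mem_sup_right hyx))
    simpa using this
  exact ⟨x, hQs a x ha this, rfl⟩

lemma not_finite_quotient {R M : Type*} [CommRing R] [AddCommGroup M] [Module R M]
    (h : ¬ Module.Finite R M) {N : Submodule R M} (hN : N.FG) : ¬ Module.Finite R (M ⧸ N) :=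
  fun _ => h <| by
    have := Module.Finite.of_fg hN
    exact Module.Finite.of_submodule_quotient N

section Dedekind

variable {R : Type*} [CommRing R] [IsDedekindDomain R]

lemma projective_of_fg {M : Type*} [AddCommGroup M] [Module R M]
    [Module.IsTorsionFree R M] {P : Submodule R M} (hP : P.FG) : Module.Projective R P := by
  have := Module.Finite.of_fg hP
  have := Module.finitePresentation_of_finite R P
  exact Module.Flat.projective_of_finitePresentation

/-- A nonzero projective module carries a nonzero functional. -/
lemma exists_dual_range_ne_bot {R M : Type*} [CommRing R] [AddCommGroup M] [Module R M]
    [Module.Projective R M] [Nontrivial M] : ∃ f : M →ₗ[R] R, LinearMap.range f ≠ ⊥ := by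
  obtain ⟨x, hx⟩ := exists_ne (0 : M)
  by_contra! h
  refine hx ((Module.forall_dual_apply_eq_zero_iff R x).1 fun f => ?_)
  have := h f
  rw [LinearMap.range_eq_bot] at this
  simp [this]

/-- Two nonzero projective modules over a Dedekind domain carry functionals with comaximal
images. -/
lemma exists_dual_range_sup_eq_top {P C : Type*} [AddCommGroup P] [Module R P]
    [AddCommGroup C] [Module R C] [Module.Projective R P] [Nontrivial P]
    [Module.Projective R C] [Nontrivial C] :
    ∃ (f : P →ₗ[R] R) (g : C →ₗ[R] R), LinearMap.range f ⊔ LinearMap.range g = ⊤ := by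
  obtain ⟨f, hf⟩ := exists_dual_range_ne_bot (R := R) (M := P)
  obtain ⟨g, hg⟩ := exists_dual_range_ne_bot (R := R) (M := C)
  set I : Ideal R := LinearMap.range f with hI
  set J : Ideal R := LinearMap.range g with hJ
  obtain ⟨c, hcJ, hc⟩ := exists_mem_ne_zero_of_ne_bot hg
  obtain ⟨J', hJ'⟩ := Ideal.dvd_span_singleton.2 hcJ
  have hJ'0 : J' ≠ 0 := by
    rintro rfl
    rw [mul_zero, Ideal.zero_eq_bot, Ideal.span_singleton_eq_bot] at hJ'
    exact hc hJ'
  -- `a J` lies in `J' J = (c)`, and `g` is rescaled by `a / c`.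
  obtain ⟨a, ha⟩ := IsDedekindDomain.exists_sup_span_eq (I := I * J') (J := J')
    Ideal.mul_le_right (mul_ne_zero hf hJ'0)
  have haJ' : a ∈ J' := ha ▸ mem_sup_right (Ideal.mem_span_singleton_self a)
  have hdvd : ∀ y, ∃ z, a * g y = c * z := fun y => by
    have : g y * a ∈ J * J' := Ideal.mul_mem_mul ⟨y, rfl⟩ haJ'
    rw [← hJ', Ideal.mem_span_singleton] at this
    obtain ⟨z, hz⟩ := this
    exact ⟨z, by rw [← hz, mul_comm]⟩
  choose g' hg' using hdvd
  let G : C →ₗ[R] R :=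
    { toFun := g'
      map_add' := fun x y => mul_left_cancel₀ hc (by
        rw [← hg', map_add, mul_add, hg', hg', mul_add])
      map_smul' := fun r x => mul_left_cancel₀ hc (by
        rw [← hg', map_smul, smul_eq_mul, RingHom.id_apply, smul_eq_mul, mul_left_comm, hg',
          mul_left_comm]) }
  refine ⟨f, G, ?_⟩
  have hG : Ideal.span {c} * (LinearMap.range G : Ideal R) = Ideal.span {a} * J := by
    ext x
    simp only [Ideal.mem_span_singleton_mul]
    constructor
    · rintro ⟨_, ⟨y, rfl⟩, rfl⟩
      exact ⟨_, ⟨y, rfl⟩, hg' y⟩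
    · rintro ⟨_, ⟨y, rfl⟩, rfl⟩
      exact ⟨_, ⟨y, rfl⟩, (hg' y).symm⟩
  have key : Ideal.span {c} * (I ⊔ LinearMap.range G) = Ideal.span {c} * ⊤ := by
    rw [← Ideal.add_eq_sup, mul_add, hG, Ideal.mul_top, hJ',
      show J * J' * I + Ideal.span {a} * J = J * (I * J' + Ideal.span {a}) by ring,
      Ideal.add_eq_sup, ha]
  exact mul_left_cancel₀ (by simpa using hc) key

variable {M : Type*} [AddCommGroup M] [Module R M] [Module.IsTorsionFree R M]

/-- A torsion-free module with finitely generated hulls that is not finitely generated contains an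
element spanning a saturated submodule: two projective summands `P ⊕ C` of a saturated submodule
carry functionals `f`, `g` with `f p + g c = 1` for suitable `p` and `c`, and `p + c` will do. -/
lemma HasFGHulls.exists_saturated_span_singleton (h : HasFGHulls R M)
    (hM : ¬ Module.Finite R M) : ∃ q : M, q ≠ 0 ∧ (span R {q}).IsSaturated := by
  have hnt : Nontrivial M := by
    by_contra hs
    rw [not_nontrivial_iff_subsingleton] at hs
    exact hM inferInstance
  obtain ⟨x, hx⟩ := exists_ne (0 : M)
  obtain ⟨P, hxP, hPfg, hPs⟩ := h _ (fg_span_singleton x)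
  rw [span_singleton_le_iff_mem] at hxP
  have hq := not_finite_quotient hM hPfg
  have hnt' : Nontrivial (M ⧸ P) := by
    by_contra hs
    rw [not_nontrivial_iff_subsingleton] at hs
    exact hq inferInstance
  obtain ⟨y, hy⟩ := exists_ne (0 : M ⧸ P)
  have htf := hPs.isTorsionFree
  obtain ⟨H, hyH, hHfg, hHs⟩ := h.quotient hPfg _ (fg_span_singleton y)
  rw [span_singleton_le_iff_mem] at hyH
  have := projective_of_fg hHfg
  have := projective_of_fg hPfg
  obtain ⟨C, hdis, hsup, ⟨e⟩⟩ := P.exists_lift_of_projective H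
  have : Module.Projective R C := Module.Projective.of_equiv e.symm
  have : Nontrivial P := ⟨⟨x, hxP⟩, 0, fun h => hx (congrArg Subtype.val h)⟩
  have : Nontrivial H := ⟨⟨y, hyH⟩, 0, fun h => hy (congrArg Subtype.val h)⟩
  have : Nontrivial C := e.toEquiv.nontrivial
  obtain ⟨f, g, hfg⟩ := exists_dual_range_sup_eq_top (R := R) (P := P) (C := C)
  have h1 : (1 : R) ∈ LinearMap.range f ⊔ LinearMap.range g := by rw [hfg]; trivial
  obtain ⟨_, ⟨p, rfl⟩, _, ⟨c, rfl⟩, hpc⟩ := mem_sup.1 h1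
  refine ⟨p + c, fun h0 => ?_, fun a m ha hm => ?_⟩
  · have hc : (c : M) = 0 := disjoint_def.1 hdis _
      (by rw [← neg_eq_of_add_eq_zero_right h0]; exact P.neg_mem p.2) c.2
    have hp : (p : M) = 0 := by simpa [hc] using h0
    rw [show c = 0 from Subtype.ext hc, show p = 0 from Subtype.ext hp] at hpc
    simp at hpc
  · obtain ⟨r, hr⟩ := mem_span_singleton.1 hm
    have hmem : m ∈ P ⊔ C := by
      rw [hsup]
      refine hHs.comap_mkQ a m ha ?_
      rw [← hr, ← hsup]
      exact smul_mem _ _ (add_mem (mem_sup_left p.2) (mem_sup_right c.2))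
    obtain ⟨p', hp', c', hc', rfl⟩ := mem_sup.1 hmem
    lift p' to P using hp'
    lift c' to C using hc'
    have hd : r • (p : M) - a • p' = a • c' - r • c := by
      rw [sub_eq_sub_iff_add_eq_add, ← smul_add, hr, ← smul_add, add_comm (c' : M)]
    have h0 : r • (p : M) - a • p' = 0 := disjoint_def.1 hdis _
      (P.sub_mem (P.smul_mem _ p.2) (P.smul_mem _ p'.2))
      (hd ▸ C.sub_mem (C.smul_mem _ c'.2) (C.smul_mem _ c.2))
    have hp : r • p = a • p' := Subtype.ext (sub_eq_zero.1 h0)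
    have hc : a • c' = r • c := Subtype.ext (sub_eq_zero.1 (hd ▸ h0))
    have hra : r = a * (f p' + g c') := by
      have h1 := congrArg f hp
      have h2 := congrArg g hc
      simp only [map_smul, smul_eq_mul] at h1 h2
      rw [mul_add, ← h1, h2, ← mul_add, hpc, mul_one]
    refine mem_span_singleton.2 ⟨f p' + g c', ?_⟩
    refine smul_right_injective M ha ?_
    dsimp only
    rw [smul_smul, ← hra, hr]

/-- A torsion-free module with finitely generated hulls that is not finitely generated contains
saturated free submodules of every finite rank. -/
lemma HasFGHulls.exists_saturated_free (n : ℕ) : ∀ {M : Type*} [AddCommGroup M] [Module R M]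
    [Module.IsTorsionFree R M], HasFGHulls R M → ¬ Module.Finite R M →
    ∃ F : Submodule R M, F.IsSaturated ∧ Nonempty (F ≃ₗ[R] (Fin n → R)) := by
  induction n with
  | zero =>
    intro M _ _ _ _ _
    refine ⟨⊥, fun a x ha hx => ?_, ⟨?_⟩⟩
    · simpa [ha] using hx
    · exact LinearEquiv.ofSubsingleton _ _
  | succ n ih =>
    intro M _ _ _ h hM
    obtain ⟨q, hq, hqs⟩ := h.exists_saturated_span_singleton hM
    have := hqs.isTorsionFree
    obtain ⟨H, hHs, ⟨e⟩⟩ := ih (h.quotient (fg_span_singleton q))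
      (not_finite_quotient hM (fg_span_singleton q))
    have : Module.Projective R H := Module.Projective.of_equiv e.symm
    obtain ⟨C, hdis, hsup, ⟨e'⟩⟩ := (span R {q}).exists_lift_of_projective H
    refine ⟨span R {q} ⊔ C, hsup ▸ hHs.comap_mkQ, ?_⟩
    obtain ⟨e''⟩ := nonempty_prod_equiv_sup hdis
    exact ⟨e''.symm.trans (((LinearEquiv.toSpanNonzeroSingleton R M q hq).symm.prodCongr
      (e'.trans e)).trans (Fin.consLinearEquiv R fun _ => R))⟩

/-- In a torsion-free module with finitely generated hulls that is not finitely generated, each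
element lies in a finitely generated free saturated submodule: the hull `P` of the element is
projective, and `P ⊕ P'` is free for a `P'` that occurs in a free part of the rest. -/
lemma HasFGHulls.exists_free_saturated_mem (h : HasFGHulls R M) (hM : ¬ Module.Finite R M)
    (m : M) : ∃ H : Submodule R M, m ∈ H ∧ H.FG ∧ H.IsSaturated ∧ Module.Free R H := by
  obtain ⟨P, hmP, hPfg, hPs⟩ := h _ (fg_span_singleton m)
  rw [span_singleton_le_iff_mem] at hmP
  have := projective_of_fg hPfg
  have := hPs.isTorsionFree
  have := Module.Finite.of_fg hPfg
  obtain ⟨n, π, hπ⟩ := Module.Finite.exists_fin' R P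
  obtain ⟨s, hs⟩ := Module.projective_lifting_property π LinearMap.id hπ
  obtain ⟨F, hFs, ⟨e⟩⟩ := HasFGHulls.exists_saturated_free n (h.quotient hPfg)
    (not_finite_quotient hM hPfg)
  let j : (Fin n → R) →ₗ[R] M ⧸ P := F.subtype ∘ₗ e.symm.toLinearMap
  have hj : Function.Injective j := F.subtype_injective.comp e.symm.injective
  -- `P''` is a copy of the kernel of a surjection `π : Rⁿ → P`, so `P ⊕ P''` is free.
  let P'' : Submodule R (M ⧸ P) := (LinearMap.ker π).map j
  have hP''s : P''.IsSaturated := by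
    rintro a x ha ⟨y, hy, hyx⟩
    have hxF : x ∈ F := hFs a x ha (hyx ▸ (e.symm y).2)
    obtain ⟨z, hz⟩ : ∃ z, j z = x := ⟨e ⟨x, hxF⟩, by simp [j]⟩
    have hyz : y = a • z := hj (by rw [hyx, map_smul, hz])
    refine ⟨z, ?_, hz⟩
    have hy0 : π y = 0 := hy
    rw [hyz, map_smul] at hy0
    exact (smul_eq_zero.1 hy0).resolve_left ha
  have e1 : LinearMap.ker π ≃ₗ[R] P'' := Submodule.equivMapOfInjective j hj _
  have hPfg' : P''.FG := (IsNoetherian.noetherian (LinearMap.ker π)).map j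
  have := projective_of_fg hPfg'
  obtain ⟨C, hdis, hsup, ⟨e2⟩⟩ := P.exists_lift_of_projective P''
  obtain ⟨e3⟩ := nonempty_prod_equiv_sup hdis
  have hCfg : C.FG := by
    have := Module.Finite.of_fg hPfg'
    rw [← Module.Finite.iff_fg]
    exact Module.Finite.equiv e2.symm
  have hex : Function.Exact (LinearMap.ker π).subtype π := LinearMap.exact_subtype_ker_map π
  have e4 : (Fin n → R) ≃ₗ[R] LinearMap.ker π × P :=
    (hex.splitSurjectiveEquiv (subtype_injective _) ⟨s, hs⟩).1
  refine ⟨P ⊔ C, mem_sup_left hmP, hPfg.sup hCfg, hsup ▸ hP''s.comap_mkQ, ?_⟩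
  have e5 : (P ⊔ C : Submodule R M) ≃ₗ[R] (Fin n → R) := e3.symm.trans
    ((LinearEquiv.prodComm R P C).trans (((e2.trans e1.symm).prodCongr (.refl R P)).trans e4.symm))
  exact Module.Free.of_equiv e5.symm

/-- A countable torsion-free module with finitely generated hulls that is not finitely generated is
free: a basis is built by enumerating the module and extending, at each step, a basis of a finitely
generated saturated submodule so that its span contains the next element. -/
lemma HasFGHulls.free_of_countable [Countable M] (h : HasFGHulls R M)
    (hM : ¬ Module.Finite R M) : Module.Free R M := by
  let Good : Set M → Prop := fun B =>
    LinearIndepOn R id B ∧ (span R B).FG ∧ (span R B).IsSaturated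
  have step : ∀ (B : Set M) (m : M), Good B → ∃ B', Good B' ∧ B ⊆ B' ∧ m ∈ span R B' := by
    rintro B m ⟨hB, hBfg, hBs⟩
    have := hBs.isTorsionFree
    obtain ⟨H, hmH, hHfg, hHs, hfree⟩ := (h.quotient hBfg).exists_free_saturated_mem
      (not_finite_quotient hM hBfg) ((span R B).mkQ m)
    obtain ⟨C, hdis, hsup, ⟨e⟩⟩ := (span R B).exists_lift_of_projective H
    have : Module.Free R C := Module.Free.of_equiv e.symm
    have hCfg : C.FG := by
      have := Module.Finite.of_fg hHfg
      rw [← Module.Finite.iff_fg]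
      exact Module.Finite.equiv e.symm
    let b := Module.Free.chooseBasis R C
    let B₁ : Set M := Set.range (C.subtype ∘ b)
    have hB₁ : LinearIndepOn R id B₁ :=
      (b.linearIndependent.map' C.subtype C.ker_subtype).linearIndepOn_id
    have hspan : span R B₁ = C := by
      rw [show B₁ = C.subtype '' Set.range b from Set.range_comp _ _, ← map_span, b.span_eq]
      simp
    have hspan' : span R (B ∪ B₁) = H.comap (span R B).mkQ := by
      rw [span_union, hspan, hsup]
    refine ⟨B ∪ B₁, ⟨hB.id_union hB₁ (by rwa [hspan]), ?_, ?_⟩, Set.subset_union_left, ?_⟩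
    · rw [span_union, hspan]
      exact hBfg.sup hCfg
    · rw [hspan']
      exact hHs.comap_mkQ
    · rw [hspan']
      exact hmH
  have h0 : Good ∅ := ⟨linearIndepOn_empty R id, by simpa using fg_bot, fun a x ha hx => by
    simpa [ha] using hx⟩
  obtain ⟨m, hm⟩ := exists_surjective_nat M
  choose! next hnext using step
  let B : ℕ → Set M := fun n => Nat.rec ∅ (fun n B => next B (m n)) n
  have hgood : ∀ n, Good (B n) := fun n => by
    induction n with
    | zero => exact h0
    | succ n ih => exact (hnext _ _ ih).1
  have hmono : Monotone B := monotone_nat_of_le_succ fun n => (hnext _ _ (hgood n)).2.1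
  have hind : LinearIndepOn R id (⋃ n, B n) :=
    linearIndepOn_iUnion_of_directed hmono.directed_le fun n => (hgood n).1
  refine Module.Free.of_basis (Module.Basis.mk hind ?_)
  rintro x -
  obtain ⟨n, rfl⟩ := hm x
  have := (hnext _ (m n) (hgood n)).2.2
  refine span_mono ?_ this
  intro y hy
  exact ⟨⟨y, Set.mem_iUnion.2 ⟨n + 1, hy⟩⟩, rfl⟩

end Dedekind

/-- A countable module over a Dedekind domain with finite torsion and finitely generated hulls is,
unless it is finitely generated, the direct sum of its torsion and a free module of rank `ℵ₀`. -/
theorem HasFGHulls.exists_isCompl_torsion {R M : Type*} [CommRing R] [IsDedekindDomain R]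
    [AddCommGroup M] [Module R M] [Countable M] (h : HasFGHulls R M)
    (hM : ¬ Module.Finite R M) (htor : Finite (torsion R M)) :
    ∃ N : Submodule R M, IsCompl (torsion R M) N ∧ Module.Free R N ∧
      Module.rank R N = Cardinal.aleph0 := by
  have hfg : (torsion R M).FG := by
    rw [← Module.Finite.iff_fg]
    infer_instance
  have hfin := not_finite_quotient hM hfg
  have : Countable (M ⧸ torsion R M) := (torsion R M).mkQ_surjective.countable
  have hfree : Module.Free R (M ⧸ torsion R M) := (h.quotient hfg).free_of_countable hfin
  have : Module.Projective R (⊤ : Submodule R (M ⧸ torsion R M)) :=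
    Module.Projective.of_equiv topEquiv.symm
  obtain ⟨N, hdis, hsup, ⟨e⟩⟩ := (torsion R M).exists_lift_of_projective ⊤
  rw [comap_top] at hsup
  have hfreeN : Module.Free R N := Module.Free.of_equiv (e.trans topEquiv).symm
  refine ⟨N, ⟨hdis, codisjoint_iff.2 hsup⟩, hfreeN, le_antisymm ?_ ?_⟩
  · rw [Module.Free.rank_eq_card_chooseBasisIndex, Cardinal.mk_le_aleph0_iff]
    exact (Module.Free.chooseBasis R N).injective.countable
  · by_contra! hlt
    have := Module.rank_lt_aleph0_iff.1 hlt
    exact hfin (Module.Finite.equiv (e.trans topEquiv))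

/-! ### Modules over a polynomial ring with a height function -/

section Height

open Polynomial

variable {k M : Type*} [Field k] [AddCommGroup M] [Module k[X] M]

/-- A height on a `k[X]`-module: a subadditive function, invariant under constants, that `X`
multiplies by `Q`. -/
structure IsHeight (h : M → ℝ) (Q : ℝ) : Prop where
  nonneg : ∀ x, 0 ≤ h x
  add_le : ∀ x y, h (x + y) ≤ h x + h y
  C_smul_le : ∀ (c : k) x, h ((C c : k[X]) • x) ≤ h x
  X_smul : ∀ x, h ((X : k[X]) • x) = Q * h x

namespace IsHeight

variable {h : M → ℝ} {Q : ℝ}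

lemma zero (hh : IsHeight (k := k) h Q) (hQ : 3 ≤ Q) : h 0 = 0 := by
  have := hh.X_smul 0
  rw [smul_zero] at this
  nlinarith [hh.nonneg 0]

lemma neg_le (hh : IsHeight (k := k) h Q) (x : M) : h (-x) ≤ h x := by
  simpa using hh.C_smul_le (-1 : k) x

lemma sub_le (hh : IsHeight (k := k) h Q) (x y : M) : h (x - y) ≤ h x + h y := by
  rw [sub_eq_add_neg]
  exact (hh.add_le x (-y)).trans (by gcongr; exact hh.neg_le y)

lemma sum_le (hh : IsHeight (k := k) h Q) (hQ : 3 ≤ Q) {ι : Type*} (s : Finset ι) (f : ι → M) :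
    h (∑ i ∈ s, f i) ≤ ∑ i ∈ s, h (f i) :=
  Finset.le_sum_of_subadditive h (hh.zero hQ).le hh.add_le s f

lemma X_pow_smul (hh : IsHeight (k := k) h Q) (n : ℕ) (x : M) :
    h ((X ^ n : k[X]) • x) = Q ^ n * h x := by
  induction n with
  | zero => simp
  | succ n ih => rw [pow_succ', mul_smul, hh.X_smul, ih]; ring

/-- The bound uses `1 + Q + ⋯ + Q ^ (n - 1) ≤ Q ^ n / 2`, which is where `3 ≤ Q` enters. -/
lemma smul_le (hh : IsHeight (k := k) h Q) (hQ : 3 ≤ Q) {p : k[X]} {n : ℕ} (hp : p.degree < n)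
    (x : M) : h (p • x) ≤ Q ^ n / 2 * h x := by
  have hx := hh.nonneg x
  have hgeom : ∀ n : ℕ, ∑ i ∈ Finset.range n, Q ^ i ≤ Q ^ n / 2 := fun n => by
    induction n with
    | zero => norm_num
    | succ n ih =>
      rw [Finset.sum_range_succ, pow_succ]
      nlinarith [pow_pos (by linarith : 0 < Q) n]
  have hp' : p = ∑ i ∈ Finset.range n, C (p.coeff i) * X ^ i := by
    ext i
    simp only [finsetSum_coeff, coeff_C_mul, coeff_X_pow, mul_ite, mul_one, mul_zero,
      Finset.sum_ite_eq, Finset.mem_range]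
    split_ifs with hi
    · rfl
    · exact coeff_eq_zero_of_degree_lt (hp.trans_le (by exact_mod_cast not_lt.1 hi))
  rw [hp', Finset.sum_smul]
  calc h (∑ i ∈ Finset.range n, (C (p.coeff i) * X ^ i : k[X]) • x)
      ≤ ∑ i ∈ Finset.range n, h ((C (p.coeff i) * X ^ i : k[X]) • x) := hh.sum_le hQ _ _
    _ ≤ ∑ i ∈ Finset.range n, Q ^ i * h x := by
      refine Finset.sum_le_sum fun i _ => ?_
      rw [mul_smul, ← hh.X_pow_smul]
      exact hh.C_smul_le _ _
    _ ≤ Q ^ n / 2 * h x := by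
      rw [← Finset.sum_mul]
      exact mul_le_mul_of_nonneg_right (hgeom n) hx

lemma le_smul (hh : IsHeight (k := k) h Q) (hQ : 3 ≤ Q) {p : k[X]} (hp : p ≠ 0)
    (x : M) : Q ^ p.natDegree / 2 * h x ≤ h (p • x) := by
  have hlc : p.leadingCoeff ≠ 0 := leadingCoeff_ne_zero.2 hp
  have h1 : h ((X ^ p.natDegree : k[X]) • x) ≤
      h ((C p.leadingCoeff * X ^ p.natDegree : k[X]) • x) := by
    have := hh.C_smul_le p.leadingCoeff⁻¹ ((C p.leadingCoeff * X ^ p.natDegree : k[X]) • x)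
    rwa [smul_smul, ← mul_assoc, ← C_mul, inv_mul_cancel₀ hlc, C_1, one_mul] at this
  have h2 : (C p.leadingCoeff * X ^ p.natDegree : k[X]) • x = p • x - p.eraseLead • x := by
    rw [← sub_smul, C_mul_X_pow_eq_monomial, ← self_sub_monomial_natDegree_leadingCoeff]
    congr 1
    ring
  have h3 := hh.smul_le hQ (p := p.eraseLead) (n := p.natDegree)
    ((degree_eraseLead_lt hp).trans_le degree_le_natDegree) x
  have h4 := hh.sub_le (p • x) (p.eraseLead • x)
  rw [← h2] at h4
  rw [hh.X_pow_smul] at h1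
  linarith

/-- If there are only finitely many points of small height, then all points that some nonzero
polynomial maps into a given finitely generated submodule lie in a finitely generated submodule.
If `a • x = ∑ bᵢ • xᵢ`, then up to `∑ k[X] xᵢ` the point `x` is determined, to within small height,
by the leading `N` digits of the expansions of the fractional parts of `bᵢ / a` in `k((1/X))`; these
take finitely many values. -/
theorem exists_fg_hull [Finite k] (hh : IsHeight (k := k) h Q) (hQ : 3 ≤ Q) {ε : ℝ} (hε : 0 < ε)
    (hfin : {x | h x < ε}.Finite) {P : Submodule k[X] M} (hP : P.FG) :
    ∃ P' : Submodule k[X] M, P'.FG ∧ ∀ (a : k[X]) (x : M), a ≠ 0 → a • x ∈ P → x ∈ P' := by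
  obtain ⟨n, v, rfl⟩ := fg_iff_exists_fin_generating_family.1 hP
  set B : ℝ := ∑ i, h (v i) with hB
  obtain ⟨N, hN⟩ := pow_unbounded_of_one_lt (2 * B / ε) (by linarith : 1 < Q)
  rw [div_lt_iff₀ hε] at hN
  have hXN : (X ^ N : k[X]).Monic := monic_X_pow N
  -- `s : D` lists the leading `N` digits of the fractional parts of the `bᵢ / a`.
  let D := Fin n → degreeLT k N
  let approx : D → M → Prop := fun s z =>
    h ((X ^ N : k[X]) • z - ∑ i, (s i : k[X]) • v i) ≤ B
  have hred : ∀ (a : k[X]) (x : M), a ≠ 0 → a • x ∈ span k[X] (Set.range v) →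
      ∃ (s : D) (z : M), x - z ∈ span k[X] (Set.range v) ∧ approx s z := by
    intro a x ha hx
    obtain ⟨b, hb⟩ := mem_span_range_iff_exists_fun k[X] |>.1 hx
    let g : Fin n → k[X] := fun i => X ^ N * b i / a
    let c : Fin n → k[X] := fun i => g i /ₘ X ^ N
    refine ⟨fun i => ⟨g i %ₘ X ^ N, mem_degreeLT.2 ?_⟩, x - ∑ i, c i • v i, ?_, ?_⟩
    · simpa using degree_modByMonic_lt (g i) hXN
    · rw [sub_sub_cancel]
      exact sum_mem fun i _ => smul_mem _ _ (subset_span ⟨i, rfl⟩)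
    · have hy : (X ^ N : k[X]) • (x - ∑ i, c i • v i) - ∑ i, (g i %ₘ X ^ N) • v i =
          (X ^ N : k[X]) • x - ∑ i, g i • v i := by
        rw [smul_sub, sub_sub, Finset.smul_sum, ← Finset.sum_add_distrib]
        congr 1
        refine Finset.sum_congr rfl fun i _ => ?_
        rw [smul_smul, ← add_smul, add_comm, modByMonic_add_div]
      have hay : a • ((X ^ N : k[X]) • x - ∑ i, g i • v i) = ∑ i, (X ^ N * b i % a) • v i := by
        rw [smul_sub, smul_comm, ← hb, Finset.smul_sum, Finset.smul_sum, ← Finset.sum_sub_distrib]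
        refine Finset.sum_congr rfl fun i _ => ?_
        rw [smul_smul, smul_smul, ← sub_smul, EuclideanDomain.mod_eq_sub_mul_div]
      change h _ ≤ B
      dsimp only
      rw [hy]
      have h1 := hh.le_smul hQ ha ((X ^ N : k[X]) • x - ∑ i, g i • v i)
      rw [hay] at h1
      have h2 : h (∑ i, (X ^ N * b i % a) • v i) ≤ Q ^ a.natDegree / 2 * B := by
        rw [hB, Finset.mul_sum]
        refine (hh.sum_le hQ _ _).trans (Finset.sum_le_sum fun i _ => hh.smul_le hQ ?_ _)
        rw [← degree_eq_natDegree ha]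
        exact EuclideanDomain.mod_lt _ ha
      exact le_of_mul_le_mul_left (h1.trans h2) (by positivity)
  have : Finite (degreeLT k N) := Module.finite_of_finite k
  classical
  let rep : D → M := fun s => if hs : ∃ z, approx s z then hs.choose else 0
  refine ⟨span k[X] (Set.range v) ⊔ span k[X] (Set.range rep) ⊔ span k[X] {x | h x < ε},
    (hP.sup (fg_span (Set.finite_range rep))).sup (fg_span hfin), fun a x ha hx => ?_⟩
  obtain ⟨s, z, hxz, hz⟩ := hred a x ha hx
  have hs : ∃ z, approx s z := ⟨z, hz⟩
  have hrep : approx s (rep s) := by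
    simp only [rep, dif_pos hs]
    exact hs.choose_spec
  have hsmall : h (z - rep s) < ε := by
    have h1 := hh.sub_le _ _ |>.trans (add_le_add hz hrep)
    rw [sub_sub_sub_cancel_right, ← smul_sub, hh.X_pow_smul] at h1
    have : 0 < Q ^ N := by positivity
    by_contra! hle
    nlinarith
  rw [show x = (x - z) + rep s + (z - rep s) by abel]
  exact add_mem (mem_sup_left (add_mem (mem_sup_left hxz) (mem_sup_right (subset_span ⟨s, rfl⟩))))
    (mem_sup_right (subset_span hsmall))

end IsHeight

end Height

/-! ### Passing from `k[X]` to a finite rank extension -/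

section FiniteRank

open Polynomial Pointwise

/-- A module of finite rank over a domain is torsion over a finitely generated submodule. -/
lemma exists_finite_forall_smul_mem_span {R M : Type*} [CommRing R] [IsDomain R] [AddCommGroup M]
    [Module R M] (h : Module.rank R M < Cardinal.aleph0) :
    ∃ s : Set M, s.Finite ∧ ∀ x : M, ∃ a : R, a ≠ 0 ∧ a • x ∈ span R s := by
  obtain ⟨s, hs, hind⟩ := exists_set_linearIndependent_of_isDomain R M
  refine ⟨s, Cardinal.lt_aleph0_iff_set_finite.1 (hs ▸ h), fun x => ?_⟩
  have h1 := rank_quotient_add_rank_of_isDomain (span R s)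
  have h2 : Module.rank R (span R s) = Module.rank R M := by
    rw [← hs]
    simpa using rank_span_set hind
  have h3 : Module.rank R (M ⧸ span R s) = 0 := by
    rw [h2] at h1
    exact Cardinal.eq_of_add_eq_add_right (by rw [h1, zero_add]) h
  obtain ⟨a, ha, hax⟩ := rank_eq_zero_iff.1 h3 ((span R s).mkQ x)
  exact ⟨a, ha, by rwa [← map_smul, mkQ_apply, Quotient.mk_eq_zero] at hax⟩

/-- A nonconstant element `t` of a function field `E` of one variable over `k` makes `E` an
algebraic `k[X]`-algebra of finite rank. -/
lemma isAlgebraic_and_rank_lt_aleph0 {k E : Type*} [Field k] [Field E] [Algebra k E]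
    (hfg : (⊤ : IntermediateField k E).FG) (htr : Algebra.trdeg k E = 1)
    [Algebra k[X] E] [IsScalarTower k k[X] E] [FaithfulSMul k[X] E] :
    Algebra.IsAlgebraic k[X] E ∧ Module.rank k[X] E < Cardinal.aleph0 := by
  let t : E := algebraMap k[X] E X
  have haeval : ∀ f : k[X], algebraMap k[X] E f = aeval t f := fun f => by
    have : IsScalarTower.toAlgHom k k[X] E = aeval t := by ext; simp [t]
    exact congrArg (fun g => g f) this
  have ht : Transcendental k t := by
    rw [transcendental_iff_injective]
    intro f g hfg
    rw [← haeval, ← haeval] at hfg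
    exact FaithfulSMul.algebraMap_injective k[X] E hfg
  have hind : AlgebraicIndependent k fun _ : Unit => t := algebraicIndependent_unique_type_iff.2 ht
  have hbasis := hind.isTranscendenceBasis_of_lift_trdeg_le_of_finite (by simp [htr])
  have halg' := hbasis.isAlgebraic
  have halg : Algebra.IsAlgebraic k[X] E := by
    refine ⟨fun x => ?_⟩
    obtain ⟨f, hf0, hf⟩ := halg'.1 x
    have hmem : ∀ g : k[X], algebraMap k[X] E g ∈ Algebra.adjoin k (Set.range fun _ : Unit => t) :=
      fun g => by
        rw [Set.range_const, Algebra.adjoin_singleton_eq_range_aeval, haeval]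
        exact ⟨g, rfl⟩
    let e : k[X] ≃+* Algebra.adjoin k (Set.range fun _ : Unit => t) :=
      RingEquiv.ofBijective ((algebraMap k[X] E).codRestrict _ hmem) (by
        refine ⟨fun a b hab => FaithfulSMul.algebraMap_injective k[X] E (congrArg Subtype.val hab),
          ?_⟩
        rintro ⟨y, hy⟩
        have hy' := hy
        rw [Set.range_const, Algebra.adjoin_singleton_eq_range_aeval] at hy'
        obtain ⟨g, rfl⟩ := hy'
        exact ⟨g, Subtype.ext (haeval g)⟩)
    refine ⟨f.map e.symm.toRingHom, (Polynomial.map_ne_zero_iff e.symm.injective).2 hf0, ?_⟩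
    rw [aeval_def, eval₂_map, ← hf, aeval_def]
    congr 1
    refine RingHom.ext fun y => ?_
    obtain ⟨g, rfl⟩ := e.surjective y
    simp only [RingEquiv.toRingHom_eq_coe, RingHom.comp_apply, RingHom.coe_coe,
      RingEquiv.symm_apply_apply]
    rfl
  refine ⟨halg, ?_⟩
  let _ : Algebra (FractionRing k[X]) E := FractionRing.liftAlgebra k[X] E
  have _ : IsScalarTower k[X] (FractionRing k[X]) E := FractionRing.isScalarTower_liftAlgebra k[X] E
  have _ : IsScalarTower k (FractionRing k[X]) E := IsScalarTower.of_algebraMap_eq fun x => by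
    rw [IsScalarTower.algebraMap_apply k k[X] E, IsScalarTower.algebraMap_apply k k[X]
      (FractionRing k[X]), ← IsScalarTower.algebraMap_apply k[X] (FractionRing k[X]) E]
  have halgF : Algebra.IsAlgebraic (FractionRing k[X]) E :=
    IsFractionRing.comap_isAlgebraic_iff.1 halg
  rw [← IsLocalization.rank_eq (FractionRing k[X]) (nonZeroDivisors k[X]) le_rfl]
  obtain ⟨s, hs⟩ := hfg
  have htop : IntermediateField.adjoin (FractionRing k[X]) (s : Set E) = ⊤ := by
    rw [eq_top_iff]
    intro x _
    have hx : x ∈ IntermediateField.adjoin k (s : Set E) := hs ▸ IntermediateField.mem_top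
    have hle : IntermediateField.adjoin k (s : Set E) ≤
        (IntermediateField.adjoin (FractionRing k[X]) (s : Set E)).restrictScalars k :=
      IntermediateField.adjoin_le_iff.2 (IntermediateField.subset_adjoin _ _)
    exact hle hx
  have hfd : FiniteDimensional (FractionRing k[X])
      (IntermediateField.adjoin (FractionRing k[X]) (s : Set E)) :=
    IntermediateField.finiteDimensional_adjoin fun x _ => (halgF.1 x).isIntegral
  rw [htop] at hfd
  have : FiniteDimensional (FractionRing k[X]) E :=
    Module.Finite.equiv IntermediateField.topEquiv.toLinearEquiv
  exact Module.rank_lt_aleph0 _ _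

namespace IsHeight

variable {k A M : Type*} [Field k] [Finite k] [CommRing A] [IsDomain A] [AddCommGroup M]
  [Module k[X] M] [Module A M] [Algebra k[X] A] [IsScalarTower k[X] A M] {h : M → ℝ} {Q ε : ℝ}

/-- The version of `IsHeight.exists_fg_hull` for a `k[X]`-algebra `A` of finite rank. -/
lemma exists_fg_hull_of_rank_lt_aleph0 (hh : IsHeight (k := k) h Q) (hQ : 3 ≤ Q) (hε : 0 < ε)
    (hfin : {x | h x < ε}.Finite) [Algebra.IsAlgebraic k[X] A]
    (hA : Module.rank k[X] A < Cardinal.aleph0) {P : Submodule A M} (hP : P.FG) :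
    ∃ P' : Submodule k[X] M, P'.FG ∧ ∀ (a : A) (x : M), a ≠ 0 → a • x ∈ P → x ∈ P' := by
  obtain ⟨s, hs, hspan⟩ := exists_finite_forall_smul_mem_span hA
  obtain ⟨u, rfl⟩ := hP
  have hfg : (span k[X] (s • (u : Set M))).FG := fg_span (hs.smul u.finite_toSet)
  obtain ⟨P', hP', hP'mem⟩ := hh.exists_fg_hull hQ hε hfin hfg
  have hmem : ∀ y ∈ span A (u : Set M), ∃ p : k[X], p ≠ 0 ∧
      p • y ∈ span k[X] (s • (u : Set M)) := by
    intro y hy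
    induction hy using closure_induction with
    | zero => exact ⟨1, one_ne_zero, by simp⟩
    | add y z _ _ hy hz =>
      obtain ⟨p, hp, hpy⟩ := hy
      obtain ⟨r, hr, hrz⟩ := hz
      refine ⟨p * r, mul_ne_zero hp hr, ?_⟩
      rw [smul_add]
      refine add_mem ?_ ?_
      · rw [mul_comm, mul_smul]
        exact smul_mem _ _ hpy
      · rw [mul_smul]
        exact smul_mem _ _ hrz
    | smul_mem a y hy =>
      obtain ⟨p, hp, hps⟩ := hspan a
      refine ⟨p, hp, ?_⟩
      rw [← smul_assoc]
      refine (span_le (p := (span k[X] (s • (u : Set M))).comap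
        (LinearMap.toSpanSingleton A M y |>.restrictScalars k[X]))).2 (fun c hc => ?_) hps
      exact subset_span (Set.smul_mem_smul hc hy)
  refine ⟨P', hP', fun a x ha hx => ?_⟩
  obtain ⟨r, hr, b, hb⟩ := (Algebra.IsAlgebraic.isAlgebraic (R := k[X]) a).exists_nonzero_dvd
    (mem_nonZeroDivisors_of_ne_zero ha)
  obtain ⟨p, hp, hpx⟩ := hmem (r • x) (by
    rw [← algebraMap_smul A r x, hb, mul_comm, mul_smul]
    exact smul_mem _ _ hx)
  exact hP'mem (p * r) x (mul_ne_zero hp hr) (by rwa [mul_smul])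

omit [IsDomain A] in
/-- If `M` contains a point that no nonzero element of `A` kills, then `A` is finite over `k[X]`:
it embeds into the finitely generated hull of a finitely generated `k[X]`-submodule of `M`. -/
lemma finite_of_torsion_free_point (hh : IsHeight (k := k) h Q) (hQ : 3 ≤ Q) (hε : 0 < ε)
    (hfin : {x | h x < ε}.Finite) (hA : Module.rank k[X] A < Cardinal.aleph0) {x : M}
    (hx : ∀ a : A, a • x = 0 → a = 0) : Module.Finite k[X] A := by
  obtain ⟨s, hs, hspan⟩ := exists_finite_forall_smul_mem_span hA
  let f : A →ₗ[k[X]] M := (LinearMap.toSpanSingleton A M x).restrictScalars k[X]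
  have hf : Function.Injective f := (injective_iff_map_eq_zero f).2 hx
  obtain ⟨P', hP', hP'mem⟩ := hh.exists_fg_hull hQ hε hfin ((fg_span hs).map f)
  have := Module.Finite.of_fg hP'
  have hmem : ∀ a, f a ∈ P' := fun a => by
    obtain ⟨p, hp, hpa⟩ := hspan a
    exact hP'mem p _ hp (by rw [← map_smul]; exact mem_map_of_mem hpa)
  exact Module.Finite.of_injective (f.codRestrict P' hmem) fun a b hab =>
    hf (congrArg Subtype.val hab)

/-- Finitely many points of small height force finitely generated hulls over `A`. -/
lemma hasFGHulls (hh : IsHeight (k := k) h Q) (hQ : 3 ≤ Q) (hε : 0 < ε)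
    (hfin : {x | h x < ε}.Finite) [Algebra.IsAlgebraic k[X] A]
    [Module.Finite k[X] A] (hA : Module.rank k[X] A < Cardinal.aleph0) : HasFGHulls A M := by
  intro P hP
  obtain ⟨P', hP', hmem⟩ := hh.exists_fg_hull_of_rank_lt_aleph0 hQ hε hfin hA hP
  let H : Submodule A M := (torsion A (M ⧸ P)).comap P.mkQ
  have hH : ∀ x, x ∈ H ↔ ∃ a : A, a ≠ 0 ∧ a • x ∈ P := fun x => by
    rw [mem_comap, mem_torsion_iff]
    constructor
    · rintro ⟨a, ha⟩
      refine ⟨a, nonZeroDivisors.ne_zero a.2, ?_⟩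
      rwa [← Quotient.mk_eq_zero]
    · rintro ⟨a, ha, hax⟩
      refine ⟨⟨a, mem_nonZeroDivisors_of_ne_zero ha⟩, ?_⟩
      rwa [← Quotient.mk_eq_zero] at hax
  refine ⟨H, fun x hx => (hH x).2 ⟨1, one_ne_zero, by simpa using hx⟩, ?_, fun a x ha hx => ?_⟩
  · have := Module.Finite.of_fg hP'
    have hle : H.restrictScalars k[X] ≤ P' := fun x hx => by
      obtain ⟨a, ha, hax⟩ := (hH x).1 hx
      exact hmem a x ha hax
    have : Module.Finite k[X] (H.restrictScalars k[X]) :=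
      Module.Finite.of_injective (inclusion hle) (inclusion_injective hle)
    have : Module.Finite k[X] H := this
    rw [← Module.Finite.iff_fg]
    exact Module.Finite.of_restrictScalars_finite k[X] A H
  · obtain ⟨b, hb, hbx⟩ := (hH _).1 hx
    exact (hH x).2 ⟨b * a, mul_ne_zero hb ha, by rwa [mul_smul]⟩

end IsHeight

end FiniteRank

open WithZero

/-! ### Additive polynomials over a discretely valued field -/

section Local

variable {L : Type*} [Field L]

/-- The additive map `T` is `y ↦ ∑ bᵢ y ^ (q ^ i)` (`i ≤ D`), where `b_D = 1` and `D ≥ 1`. -/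
structure IsMonicAdditive (q D : ℕ) (b : ℕ → L) (T : L →+ L) : Prop where
  two_le : 2 ≤ q
  one_le : 1 ≤ D
  monic : b D = 1
  eval : ∀ y, T y = ∑ i ∈ Finset.range (D + 1), b i * y ^ (q ^ i)

namespace IsMonicAdditive

variable {q D : ℕ} {b : ℕ → L} {T : L →+ L} (hT : IsMonicAdditive q D b T)
  (w : Valuation L ℤᵐ⁰) {m : ℕ}
include hT

lemma two_le_pow : 2 ≤ q ^ D :=
  hT.two_le.trans (Nat.le_self_pow (by have := hT.one_le; omega) q)

lemma pow_add_one_le {i : ℕ} (hi : i < D) : q ^ i + 1 ≤ q ^ D :=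
  Nat.pow_lt_pow_right hT.two_le hi

/-- Far away from the origin the leading term dominates. -/
lemma map_eq_pow (hb : ∀ i < D, w (b i) ≤ exp (m : ℤ)) {y : L} (hy : exp (m : ℤ) < w y) :
    w (T y) = w y ^ q ^ D := by
  have h1 : 1 < w y := lt_of_le_of_lt (by rw [← exp_zero, exp_le_exp]; exact_mod_cast m.zero_le) hy
  have hy0 : (0 : ℤᵐ⁰) < w y := zero_lt_one.trans h1
  have hlt : w (∑ i ∈ Finset.range D, b i * y ^ (q ^ i)) < w (y ^ q ^ D) := by
    refine w.map_sum_lt (by rw [map_pow]; exact (pow_pos hy0 _).ne') fun i hi => ?_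
    have hi := Finset.mem_range.1 hi
    rw [map_mul, map_pow, map_pow]
    calc w (b i) * w y ^ q ^ i ≤ exp (m : ℤ) * w y ^ q ^ i := mul_le_mul_left (hb i hi) _
      _ < w y * w y ^ q ^ i := mul_lt_mul_of_pos_right hy (pow_pos hy0 _)
      _ = w y ^ (q ^ i + 1) := (pow_succ' _ _).symm
      _ ≤ w y ^ q ^ D := pow_le_pow_right₀ h1.le (hT.pow_add_one_le hi)
  rw [hT.eval, Finset.sum_range_succ, hT.monic, one_mul, w.map_add_eq_of_lt_right hlt, map_pow]

lemma map_le (hb : ∀ i < D, w (b i) ≤ exp (m : ℤ)) {y : L} (hy : w y ≤ exp (m : ℤ)) :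
    w (T y) ≤ exp ((q ^ D * m : ℕ) : ℤ) := by
  have hpow : ∀ i, w y ^ q ^ i ≤ exp ((q ^ i * m : ℕ) : ℤ) := fun i => by
    refine (pow_le_pow_left₀ zero_le hy _).trans_eq ?_
    rw [← exp_nsmul]
    simp
  rw [hT.eval]
  refine w.map_sum_le fun i hi => ?_
  rw [map_mul, map_pow]
  rcases (Finset.mem_range_succ_iff.1 hi).lt_or_eq with hi | rfl
  · calc w (b i) * w y ^ q ^ i ≤ exp (m : ℤ) * exp ((q ^ i * m : ℕ) : ℤ) :=
        mul_le_mul' (hb i hi) (hpow i)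
      _ = exp (((q ^ i + 1) * m : ℕ) : ℤ) := by
        rw [← exp_add]
        congr 1
        push_cast
        ring
      _ ≤ _ := by
        rw [exp_le_exp]
        exact_mod_cast Nat.mul_le_mul_right m (hT.pow_add_one_le hi)
  · rw [hT.monic, map_one, one_mul]
    exact hpow i

/-- If `n ≥ 0` and some coefficient of `T` is not integral, then the elements `z` such that `z` and
`T z` both have absolute value at most `exp n` lie in finitely many cosets of the open ball of
radius `exp n`: in terms of `u = z / ϖ`, where `ϖ` has absolute value `exp n`, the reduction of `u`
is a root of a nonzero polynomial over the residue field. -/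
lemma exists_finite_cover_step (hw : Function.Surjective w) {n : ℕ}
    (hbad : ∃ i < D, 1 < w (b i)) :
    ∃ F : Set L, F.Finite ∧ ∀ z, w z ≤ exp (n : ℤ) → w (T z) ≤ exp (n : ℤ) →
      ∃ f ∈ F, w (z - f) < exp (n : ℤ) := by
  obtain ⟨ϖ, hϖ⟩ := hw (exp (n : ℤ))
  have hϖ0 : ϖ ≠ 0 := by
    rintro rfl
    rw [map_zero] at hϖ
    exact exp_ne_zero hϖ.symm
  let β : ℕ → L := fun i => b i * ϖ ^ q ^ i
  obtain ⟨k, hk, hmax⟩ := Finset.exists_max_image (Finset.range (D + 1)) (fun i => w (β i))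
    ⟨0, by simp⟩
  have hβ : exp (n : ℤ) < w (β k) := by
    obtain ⟨i, hi, hbi⟩ := hbad
    refine lt_of_lt_of_le ?_ (hmax i (by simp; omega))
    simp only [β]
    rw [map_mul, map_pow, hϖ]
    have hq : q ^ i ≠ 0 := pow_ne_zero _ (by have := hT.two_le; omega)
    have h1 : (1 : ℤᵐ⁰) ≤ exp (n : ℤ) := by
      rw [← exp_zero, exp_le_exp]
      exact_mod_cast n.zero_le
    calc exp (n : ℤ) = 1 * exp (n : ℤ) := (one_mul _).symm
      _ < w (b i) * exp (n : ℤ) := mul_lt_mul_of_pos_right hbi exp_pos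
      _ ≤ w (b i) * exp (n : ℤ) ^ q ^ i := mul_le_mul_right (le_self_pow₀ h1 hq) _
  have hβ0 : β k ≠ 0 := by
    intro h0
    rw [h0, map_zero] at hβ
    exact not_lt_zero hβ
  let O := w.valuationSubring
  let κ := IsLocalRing.ResidueField O
  have hc : ∀ i, w (β i / β k) ≤ 1 ∨ D < i := fun i => by
    by_cases hi : i < D + 1
    · left
      rw [map_div₀, div_le_one₀ (zero_lt_iff.2 (by simpa using hβ0))]
      exact hmax i (by simpa using hi)
    · right; omega
  let c : ℕ → O := fun i => if h : w (β i / β k) ≤ 1 then ⟨β i / β k, h⟩ else 0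
  have hcval : ∀ i ∈ Finset.range (D + 1), (c i : L) = β i / β k := fun i hi => by
    have h : w (β i / β k) ≤ 1 := (hc i).resolve_right (by simp at hi; omega)
    simp only [c, dif_pos h]
  let p : Polynomial O := ∑ i ∈ Finset.range (D + 1), Polynomial.monomial (q ^ i) (c i)
  have hpcoeff : p.coeff (q ^ k) = 1 := by
    simp only [p, Polynomial.finsetSum_coeff, Polynomial.coeff_monomial]
    rw [Finset.sum_eq_single k]
    · rw [if_pos rfl]
      refine Subtype.ext ?_
      rw [hcval k hk, div_self hβ0]
      rfl
    · intro i _ hik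
      rw [if_neg fun h => hik (Nat.pow_right_injective hT.two_le h)]
    · exact fun h => absurd hk h
  let pbar := p.map (IsLocalRing.residue O)
  have hpbar : pbar ≠ 0 := fun h0 => by
    have := congrArg (fun f => f.coeff (q ^ k)) h0
    simp [pbar, Polynomial.coeff_map, hpcoeff] at this
  have hpeval : ∀ u : O, ((p.eval u : O) : L) = T (ϖ * u) / β k := fun u => by
    rw [hT.eval, Finset.sum_div]
    simp only [p, Polynomial.eval_finsetSum, Polynomial.eval_monomial]
    push_cast
    refine Finset.sum_congr rfl fun i hi => ?_
    rw [hcval i hi]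
    simp only [β]
    ring
  have hres : ∀ x : O, IsLocalRing.residue O x = 0 ↔ w (x : L) < 1 := fun x => by
    rw [IsLocalRing.residue_eq_zero_iff]
    exact Valuation.mem_maximalIdeal_iff (v := w)
  obtain ⟨lift, hlift⟩ := IsLocalRing.residue_surjective (R := O).hasRightInverse
  refine ⟨(fun ρ => ϖ * (lift ρ : L)) '' {ρ | pbar.IsRoot ρ},
    (Polynomial.finite_setOfPred_isRoot hpbar).image _, fun z hz hTz => ?_⟩
  have hu : w (z / ϖ) ≤ 1 := by
    rw [map_div₀, hϖ]
    exact (div_le_one₀ exp_pos).2 hz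
  let u : O := ⟨z / ϖ, hu⟩
  have hzu : ϖ * (u : L) = z := mul_div_cancel₀ z hϖ0
  refine ⟨_, ⟨IsLocalRing.residue O u, ?_, rfl⟩, ?_⟩
  · change (p.map _).eval _ = 0
    rw [Polynomial.eval_map_apply, hres, hpeval, hzu, map_div₀]
    exact (div_lt_one₀ (zero_lt_iff.2 (by simpa using hβ0))).2 (hTz.trans_lt hβ)
  · have h1 : IsLocalRing.residue O (u - lift (IsLocalRing.residue O u)) = 0 := by
      rw [map_sub, hlift, sub_self]
    rw [hres] at h1
    have h2 : z - ϖ * (lift (IsLocalRing.residue O u) : L) =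
        ϖ * ((u - lift (IsLocalRing.residue O u) : O) : L) := by
      rw [← hzu]
      push_cast
      ring
    dsimp only
    rw [h2, map_mul, hϖ]
    exact mul_lt_of_lt_one_right exp_pos h1

/-- If some coefficient of `T` is not integral, then the elements with a long enough bounded initial
orbit under `T` lie in finitely many cosets of the maximal ideal. By induction, the elements with
`k + 1` bounded iterates lie in finitely many closed balls of radius `exp (M - k)`: if two of them
lie in the same ball for `k`, together with their images, then `exists_finite_cover_step` applies to
their difference. -/
lemma exists_finite_cover (hw : Function.Surjective w) (hbad : ∃ i < D, 1 < w (b i)) (M : ℕ) :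
    ∃ F : Set L, F.Finite ∧ ∀ z, (∀ j ≤ M + 1, w (T^[j] z) ≤ exp (M : ℤ)) →
      ∃ f ∈ F, w (z - f) < 1 := by
  have key : ∀ k ≤ M + 1, ∃ F : Set L, F.Finite ∧ ∀ z, (∀ j ≤ k, w (T^[j] z) ≤ exp (M : ℤ)) →
      ∃ f ∈ F, w (z - f) ≤ exp ((M : ℤ) - k) := by
    intro k hk
    induction k with
    | zero => exact ⟨{0}, Set.finite_singleton 0, fun z hz => ⟨0, rfl, by simpa using hz 0 le_rfl⟩⟩
    | succ k ih =>
      obtain ⟨F, hF, hcov⟩ := ih (by omega)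
      obtain ⟨G, hG, hcov'⟩ := hT.exists_finite_cover_step w hw (n := M - k) hbad
      have hMk : ((M - k : ℕ) : ℤ) = M - k := by omega
      rw [hMk] at hcov'
      let near : L → L → L → Prop := fun f f' z =>
        w (z - f) ≤ exp ((M : ℤ) - k) ∧ w (T z - f') ≤ exp ((M : ℤ) - k)
      classical
      let rep : L × L → L := fun a => if h : ∃ z, near a.1 a.2 z then h.choose else 0
      refine ⟨(fun a : (L × L) × L => rep a.1 + a.2) '' ((F ×ˢ F) ×ˢ G),
        ((hF.prod hF).prod hG).image _, fun z hz => ?_⟩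
      obtain ⟨f, hf, hzf⟩ := hcov z fun j hj => hz j (by omega)
      obtain ⟨f', hf', hzf'⟩ := hcov (T z) fun j hj => by
        rw [← Function.iterate_succ_apply]
        exact hz (j + 1) (by omega)
      have hex : ∃ z, near f f' z := ⟨z, hzf, hzf'⟩
      have hrep : near f f' (rep (f, f')) := by
        simp only [rep, dif_pos hex]
        exact hex.choose_spec
      obtain ⟨g, hg, hzg⟩ := hcov' (z - rep (f, f'))
        (by rw [← sub_sub_sub_cancel_right z _ f]; exact w.map_sub_le hzf hrep.1)
        (by rw [map_sub, ← sub_sub_sub_cancel_right (T z) _ f']; exact w.map_sub_le hzf' hrep.2)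
      refine ⟨_, ⟨((f, f'), g), ⟨⟨hf, hf'⟩, hg⟩, rfl⟩, ?_⟩
      dsimp only
      rw [← sub_sub]
      by_cases h0 : w (z - rep (f, f') - g) = 0
      · rw [h0]
        exact zero_le
      · rw [← log_lt_iff_lt_exp h0] at hzg
        rw [← log_le_iff_le_exp h0]
        push_cast
        omega
  obtain ⟨F, hF, hcov⟩ := key (M + 1) le_rfl
  refine ⟨F, hF, fun z hz => ?_⟩
  obtain ⟨f, hf, hzf⟩ := hcov z hz
  refine ⟨f, hf, hzf.trans_lt ?_⟩
  rw [← exp_zero, exp_lt_exp]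
  push_cast
  omega

end IsMonicAdditive

end Local

/-! ### The height attached to an additive polynomial and a good set of valuations -/

section Excess

variable {L : Type*} [Field L]

/-- The additive size `log |y|` of `y` if it exceeds `m`, and `0` otherwise. -/
def excess (w : Valuation L ℤᵐ⁰) (m : ℕ) (y : L) : ℤ :=
  if (m : ℤ) < log (w y) then log (w y) else 0

variable (w : Valuation L ℤᵐ⁰) (m : ℕ)

lemma lt_log_iff {y : L} : (m : ℤ) < log (w y) ↔ exp (m : ℤ) < w y := by
  by_cases h0 : w y = 0
  · simp [h0]
  · exact lt_log_iff_exp_lt h0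

lemma excess_nonneg (y : L) : 0 ≤ excess w m y := by
  unfold excess
  split_ifs with h <;> omega

lemma excess_of_le {y : L} (h : w y ≤ exp (m : ℤ)) : excess w m y = 0 :=
  if_neg (by rw [lt_log_iff]; exact not_lt.2 h)

lemma excess_of_lt {y : L} (h : exp (m : ℤ) < w y) : excess w m y = log (w y) :=
  if_pos (by rwa [lt_log_iff])

/-- This covers `y = 0` as well, since `log 0 = 0`. -/
lemma excess_eq_zero_of_log {y : L} (h : log (w y) = 0) : excess w m y = 0 :=
  if_neg (by rw [h]; omega)

lemma excess_add_le (x y : L) : excess w m (x + y) ≤ excess w m x + excess w m y := by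
  have hx := excess_nonneg w m x
  have hy := excess_nonneg w m y
  by_cases h : exp (m : ℤ) < w (x + y)
  · have aux : ∀ z, w (x + y) ≤ w z → excess w m (x + y) ≤ excess w m z := fun z hz => by
      rw [excess_of_lt w m h, excess_of_lt w m (h.trans_le hz)]
      exact (log_le_log (ne_zero_of_lt h) (ne_zero_of_lt (h.trans_le hz))).2 hz
    rcases le_max_iff.1 (w.map_add x y) with h1 | h1
    · linarith [aux x h1]
    · linarith [aux y h1]
  · rw [excess_of_le w m (not_lt.1 h)]
    omega

lemma excess_mul {c : L} (hc : w c = 1) (y : L) : excess w m (c * y) = excess w m y := by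
  simp [excess, hc]

namespace IsMonicAdditive

variable {q D : ℕ} {b : ℕ → L} {T : L →+ L} (hT : IsMonicAdditive q D b T) {w} {m}
include hT

lemma excess_map_of_lt (hb : ∀ i < D, w (b i) ≤ exp (m : ℤ)) {y : L} (hy : exp (m : ℤ) < w y) :
    excess w m (T y) = q ^ D * excess w m y := by
  have h1 := hT.map_eq_pow w hb hy
  have h2 : exp (m : ℤ) < w (T y) := by
    rw [h1]
    have : (1 : ℤᵐ⁰) ≤ w y := (hy.trans_le' (by
      rw [← exp_zero, exp_le_exp]; exact_mod_cast m.zero_le)).le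
    exact hy.trans_le (le_self_pow₀ this (by have := hT.two_le_pow; omega))
  rw [excess_of_lt w m h2, excess_of_lt w m hy, h1, log_pow]
  simp

lemma le_excess_map (hb : ∀ i < D, w (b i) ≤ exp (m : ℤ)) (y : L) :
    q ^ D * excess w m y ≤ excess w m (T y) := by
  by_cases hy : exp (m : ℤ) < w y
  · exact (hT.excess_map_of_lt hb hy).ge
  · rw [excess_of_le w m (not_lt.1 hy), mul_zero]
    exact excess_nonneg w m _

lemma excess_map_le (hb : ∀ i < D, w (b i) ≤ exp (m : ℤ)) (y : L) :
    excess w m (T y) ≤ q ^ D * max (excess w m y) m := by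
  by_cases hy : exp (m : ℤ) < w y
  · rw [hT.excess_map_of_lt hb hy]
    gcongr
    exact le_max_left _ _
  · have h1 := hT.map_le w hb (not_lt.1 hy)
    have h2 : excess w m (T y) ≤ q ^ D * m := by
      by_cases h : exp (m : ℤ) < w (T y)
      · rw [excess_of_lt w m h, log_le_iff_le_exp (ne_zero_of_lt h)]
        exact_mod_cast h1
      · rw [excess_of_le w m (not_lt.1 h)]
        positivity
    refine h2.trans ?_
    gcongr
    exact le_max_right _ _

lemma excess_iterate_le (hb : ∀ i < D, w (b i) ≤ exp (m : ℤ)) (y : L) (n : ℕ) :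
    excess w m (T^[n] y) ≤ (q ^ D) ^ n * (excess w m y + m) := by
  suffices h : excess w m (T^[n] y) ≤ (q ^ D) ^ n * max (excess w m y) m by
    refine h.trans ?_
    gcongr
    have := excess_nonneg w m y
    exact max_le (by omega) (by omega)
  induction n with
  | zero => simp
  | succ n ih =>
    rw [Function.iterate_succ_apply']
    refine (hT.excess_map_le hb _).trans ?_
    rw [pow_succ', mul_assoc]
    gcongr
    refine max_le ih ?_
    have h1 : (1 : ℤ) ≤ (q ^ D) ^ n := by
      have := hT.two_le_pow
      exact one_le_pow₀ (by exact_mod_cast (by omega : 1 ≤ q ^ D))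
    nlinarith [le_max_right (excess w m y) (m : ℤ), le_max_left (excess w m y) (m : ℤ),
      (Nat.cast_nonneg m : (0 : ℤ) ≤ m)]

end IsMonicAdditive

end Excess

section GlobalHeight

variable {L : Type*} [Field L] {V : Set (DiscVal L)} {d : V → ℝ}

lemma finsum_le_finsum_of_finite {ι : Type*} {f g : ι → ℝ} (hf : f.support.Finite)
    (hg : g.support.Finite) (h : ∀ i, f i ≤ g i) : ∑ᶠ i, f i ≤ ∑ᶠ i, g i := by
  classical
  rw [finsum_eq_sum_of_support_subset (s := (hf.union hg).toFinset) f (by simp),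
    finsum_eq_sum_of_support_subset (s := (hf.union hg).toFinset) g (by simp)]
  exact Finset.sum_le_sum fun i _ => h i

lemma le_finsum_of_finite {ι : Type*} {f : ι → ℝ} (hf : f.support.Finite) (h : ∀ i, 0 ≤ f i)
    (i : ι) : f i ≤ ∑ᶠ i, f i := by
  classical
  by_cases hi : f i = 0
  · rw [hi]
    exact finsum_nonneg h
  · rw [finsum_eq_sum f hf]
    exact Finset.single_le_sum (fun j _ => h j) (by simpa using hi)

/-- The weighted sum over a good set of the sizes of `y` beyond the bounds `m w`. -/
noncomputable def totalExcess (d : V → ℝ) (m : V → ℕ) (y : L) : ℝ :=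
  ∑ᶠ w : V, d w * (excess w.1.val (m w) y : ℝ)

/-- The canonical height of an additive map `T` of degree `Q`: the limit, as a supremum, of the
total excess of `T^n y` divided by `Q ^ n`. -/
noncomputable def canonicalHeight (d : V → ℝ) (m : V → ℕ) (Q : ℕ) (T : L →+ L) (y : L) : ℝ :=
  ⨆ n : ℕ, ((Q : ℝ) ^ n)⁻¹ * totalExcess d m (T^[n] y)

lemma support_const_mul_subset {ι : Type*} (c : ℝ) (f : ι → ℝ) :
    (fun i => c * f i).support ⊆ f.support := fun i hi h0 => hi (by simp [h0])

variable (hV : IsGoodSet V d) (m : V → ℕ)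

include hV

lemma finite_support_excess (y : L) :
    (fun w : V => d w * (excess w.1.val (m w) y : ℝ)).support.Finite := by
  by_cases hy : y = 0
  · subst hy
    convert Set.finite_empty
    ext w
    simp [excess_eq_zero_of_log]
  · refine (hV.finite_support y hy).subset fun w hw => ?_
    intro h0
    refine hw ?_
    have h1 : log (w.1.val y) = 0 := by simpa [DiscVal.ord] using h0
    simp [excess_eq_zero_of_log _ _ h1]

lemma excess_term_nonneg (y : L) (w : V) : 0 ≤ d w * (excess w.1.val (m w) y : ℝ) :=
  mul_nonneg (hV.deg_pos w).le (by exact_mod_cast excess_nonneg w.1.val (m w) y)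

lemma totalExcess_nonneg (y : L) : 0 ≤ totalExcess d m y :=
  finsum_nonneg (excess_term_nonneg hV m y)

lemma totalExcess_add_le (x y : L) :
    totalExcess d m (x + y) ≤ totalExcess d m x + totalExcess d m y := by
  have hx := finite_support_excess hV m x
  have hy := finite_support_excess hV m y
  rw [totalExcess, totalExcess, totalExcess, ← finsum_add_distrib hx hy]
  refine finsum_le_finsum_of_finite (finite_support_excess hV m _)
    ((hx.union hy).subset (Function.support_add _ _)) fun w => ?_
  rw [← mul_add]
  exact mul_le_mul_of_nonneg_left (by exact_mod_cast excess_add_le w.1.val (m w) x y)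
    (hV.deg_pos w).le

omit hV in
lemma totalExcess_mul {c : L} (hc : ∀ w : V, w.1.val c = 1) (y : L) :
    totalExcess d m (c * y) = totalExcess d m y := by
  simp only [totalExcess, excess_mul _ _ (hc _)]

variable {q D : ℕ} {b : ℕ → L} {T : L →+ L} (hT : IsMonicAdditive q D b T)
  (hb : ∀ w : V, ∀ i < D, w.1.val (b i) ≤ exp (m w : ℤ))

include hT hb

lemma le_totalExcess_map (y : L) : (q : ℝ) ^ D * totalExcess d m y ≤ totalExcess d m (T y) := by
  rw [totalExcess, totalExcess, mul_finsum]
  refine finsum_le_finsum_of_finite ?_ (finite_support_excess hV m _) fun w => ?_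
  · exact (finite_support_excess hV m y).subset (support_const_mul_subset _ _)
  · rw [mul_left_comm]
    exact mul_le_mul_of_nonneg_left (by exact_mod_cast hT.le_excess_map (hb w) y) (hV.deg_pos w).le

variable (hm : {w | m w ≠ 0}.Finite)
include hm

/-- The supremum defining the canonical height is finite: passing from `T^n y` to `T^(n+1) y`
multiplies the larger of excess and bound at `w` by at most `q ^ D`. -/
lemma bddAbove_totalExcess_iterate (y : L) :
    BddAbove (Set.range fun n : ℕ => (((q ^ D : ℕ) : ℝ) ^ n)⁻¹ * totalExcess d m (T^[n] y)) := by
  refine ⟨totalExcess d m y + ∑ᶠ w : V, d w * m w, ?_⟩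
  rintro _ ⟨n, rfl⟩
  have hQ : (0 : ℝ) < ((q ^ D : ℕ) : ℝ) ^ n := by
    have := hT.two_le_pow
    exact pow_pos (by exact_mod_cast (by omega : 0 < q ^ D)) n
  have hy := finite_support_excess hV m y
  have hm' : (fun w : V => d w * (m w : ℝ)).support.Finite :=
    hm.subset fun w hw h0 => hw (by simp [h0])
  dsimp only
  rw [inv_mul_le_iff₀ hQ, totalExcess, totalExcess, ← finsum_add_distrib hy hm', mul_finsum]
  refine finsum_le_finsum_of_finite (finite_support_excess hV m _)
    (((hy.union hm').subset (Function.support_add _ _)).subset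
      (support_const_mul_subset _ _)) fun w => ?_
  rw [← mul_add, mul_left_comm]
  exact mul_le_mul_of_nonneg_left (by exact_mod_cast hT.excess_iterate_le (hb w) y n)
    (hV.deg_pos w).le

lemma le_canonicalHeight (y : L) (n : ℕ) :
    (((q ^ D : ℕ) : ℝ) ^ n)⁻¹ * totalExcess d m (T^[n] y) ≤ canonicalHeight d m (q ^ D) T y :=
  le_ciSup (bddAbove_totalExcess_iterate hV m hT hb hm y) n

lemma canonicalHeight_nonneg (y : L) : 0 ≤ canonicalHeight d m (q ^ D) T y := by
  refine le_trans ?_ (le_canonicalHeight hV m hT hb hm y 0)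
  simpa using totalExcess_nonneg hV m y

lemma canonicalHeight_add_le (x y : L) : canonicalHeight d m (q ^ D) T (x + y) ≤
    canonicalHeight d m (q ^ D) T x + canonicalHeight d m (q ^ D) T y := by
  refine ciSup_le fun n => ?_
  refine le_trans ?_ (add_le_add (le_canonicalHeight hV m hT hb hm x n)
    (le_canonicalHeight hV m hT hb hm y n))
  rw [← mul_add, iterate_map_add]
  exact mul_le_mul_of_nonneg_left (totalExcess_add_le hV m _ _) (by positivity)

lemma canonicalHeight_map (y : L) : canonicalHeight d m (q ^ D) T (T y) =
    (q ^ D : ℕ) * canonicalHeight d m (q ^ D) T y := by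
  have hQ : (0 : ℝ) < ((q ^ D : ℕ) : ℝ) := by
    have := hT.two_le_pow
    exact_mod_cast (by omega : 0 < q ^ D)
  have hstep : ∀ n : ℕ, (((q ^ D : ℕ) : ℝ) ^ n)⁻¹ * totalExcess d m (T^[n] (T y)) =
      (q ^ D : ℕ) * ((((q ^ D : ℕ) : ℝ) ^ (n + 1))⁻¹ * totalExcess d m (T^[n + 1] y)) := fun n => by
    rw [Function.iterate_succ_apply, pow_succ', mul_inv, ← mul_assoc, ← mul_assoc,
      mul_inv_cancel₀ hQ.ne', one_mul]
  refine le_antisymm (ciSup_le fun n => ?_) ?_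
  · rw [hstep]
    exact mul_le_mul_of_nonneg_left (le_canonicalHeight hV m hT hb hm y (n + 1)) hQ.le
  · rw [← le_div_iff₀' hQ]
    refine ciSup_le fun n => ?_
    rw [le_div_iff₀' hQ]
    refine le_trans ?_ (le_canonicalHeight hV m hT hb hm (T y) n)
    rw [hstep, mul_le_mul_iff_right₀ hQ, pow_succ, mul_inv, mul_assoc]
    refine mul_le_mul_of_nonneg_left ?_ (by positivity)
    rw [Function.iterate_succ_apply', ← div_eq_inv_mul, le_div_iff₀' hQ]
    exact_mod_cast le_totalExcess_map hV m hT hb (T^[n] y)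

omit hV hm hb hT in
lemma canonicalHeight_mul {Q : ℕ} {c : L} (hc : ∀ w : V, w.1.val c = 1)
    (hcT : ∀ y, T (c * y) = c * T y) (y : L) :
    canonicalHeight d m Q T (c * y) = canonicalHeight d m Q T y := by
  have hiter : ∀ n, T^[n] (c * y) = c * T^[n] y := fun n => by
    induction n with
    | zero => rfl
    | succ n ih => rw [Function.iterate_succ_apply', ih, hcT, Function.iterate_succ_apply']
  simp only [canonicalHeight, hiter, totalExcess_mul m hc]

/-- If at each valuation with a positive bound, of which there is at least one, some coefficient of
`T` is not integral, then only finitely many points have small height. Points of small height have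
a bounded orbit at the finitely many places `w` with `m w > 0`, so they lie in finitely many
residue classes there. If two of them share all these classes, their difference `z` satisfies
`|z| < 1` at those places, and its poles elsewhere contribute at most its height; the sum formula
then forces `z = 0`. -/
theorem exists_finite_canonicalHeight_lt (hbad : ∀ w : V, m w ≠ 0 → ∃ i < D, 1 < w.1.val (b i))
    (hex : ∃ w : V, m w ≠ 0) :
    ∃ ε > 0, {y | canonicalHeight d m (q ^ D) T y < ε}.Finite := by
  obtain ⟨w₀, hw₀⟩ := hex
  have hQ : (1 : ℝ) ≤ ((q ^ D : ℕ) : ℝ) := by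
    have := hT.two_le_pow
    exact_mod_cast (by omega : 1 ≤ q ^ D)
  -- A point whose orbit leaves the ball of radius `exp (m w)` within `m w + 1` steps has height at
  -- least `e w`; the bound `d w₀ / 2` serves for differences of two points.
  let e : V → ℝ := fun w => (((q ^ D : ℕ) : ℝ) ^ (m w + 1))⁻¹ * (d w * m w)
  have hev : ∀ᶠ ε in nhdsWithin (0 : ℝ) (Set.Ioi 0), ε < d w₀ / 2 ∧
      ∀ w ∈ {w | m w ≠ 0}, ε < e w := by
    have aux : ∀ c : ℝ, 0 < c → ∀ᶠ ε in nhdsWithin (0 : ℝ) (Set.Ioi 0), ε < c := fun c hc =>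
      Filter.Eventually.filter_mono nhdsWithin_le_nhds (eventually_lt_nhds hc)
    refine (aux _ (half_pos (hV.deg_pos w₀))).and ((Filter.eventually_all_finite hm).2
      fun w hw => aux _ ?_)
    have : 0 < m w := Nat.pos_of_ne_zero hw
    have := hV.deg_pos w
    positivity
  obtain ⟨ε, ⟨hε0, hε⟩, hεpos⟩ := (hev.and self_mem_nhdsWithin).exists
  refine ⟨ε, hεpos, ?_⟩
  have horbit : ∀ y, canonicalHeight d m (q ^ D) T y < ε → ∀ w : V, m w ≠ 0 →
      ∀ j ≤ m w + 1, w.1.val (T^[j] y) ≤ exp (m w : ℤ) := by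
    intro y hy w hw j hj
    by_contra! hlt
    have h1 : (m w : ℝ) ≤ excess w.1.val (m w) (T^[j] y) := by
      rw [excess_of_lt _ _ hlt]
      exact_mod_cast ((lt_log_iff _ _).2 hlt).le
    have h2 := le_finsum_of_finite (finite_support_excess hV m (T^[j] y))
      (excess_term_nonneg hV m (T^[j] y)) w
    have h3 := le_canonicalHeight hV m hT hb hm y j
    have hd := (hV.deg_pos w).le
    have h4 : e w ≤ (((q ^ D : ℕ) : ℝ) ^ j)⁻¹ * totalExcess d m (T^[j] y) := by
      refine mul_le_mul ?_ ((mul_le_mul_of_nonneg_left h1 hd).trans h2) (by positivity)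
        (by positivity)
      exact inv_anti₀ (by positivity) (pow_le_pow_right₀ hQ hj)
    linarith [hε w hw]
  have hcov : ∀ w : {w : V | m w ≠ 0}, ∃ F : Set L, F.Finite ∧ ∀ y,
      canonicalHeight d m (q ^ D) T y < ε → ∃ f ∈ F, w.1.1.val (y - f) < 1 := fun w => by
    obtain ⟨F, hF, h⟩ := hT.exists_finite_cover w.1.1.val w.1.1.surj (hbad w.1 w.2) (m w.1)
    exact ⟨F, hF, fun y hy => h y (horbit y hy w.1 w.2)⟩
  choose F hF hcov using hcov
  choose! f hfF hf using hcov
  have := hm.to_subtype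
  have := fun w => (hF w).to_subtype
  let g : {y // canonicalHeight d m (q ^ D) T y < ε} → ∀ w : {w | m w ≠ 0}, F w :=
    fun y w => ⟨f w y, hfF w y y.2⟩
  refine Set.finite_coe_iff.1 (Finite.of_injective g ?_)
  rintro ⟨x, hx⟩ ⟨y, hy⟩ hxy
  have hneg : canonicalHeight d m (q ^ D) T (-y) < ε := by
    have := canonicalHeight_mul m (Q := q ^ D) (T := T) (d := d) (c := -1)
      (fun w => by simp [Valuation.map_neg]) (fun z => by simp) y
    rw [neg_one_mul] at this
    rwa [this]
  have hz : totalExcess d m (x - y) < d w₀ := by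
    have h1 := le_canonicalHeight hV m hT hb hm (x - y) 0
    have h2 := canonicalHeight_add_le hV m hT hb hm x (-y)
    rw [← sub_eq_add_neg] at h2
    simp only [pow_zero, inv_one, one_mul, Function.iterate_zero, id] at h1
    have hx' : canonicalHeight d m (q ^ D) T x < ε := hx
    linarith
  have hclose : ∀ w : V, m w ≠ 0 → w.1.val (x - y) < 1 := fun w hw => by
    have h1 := hf ⟨w, hw⟩ x hx
    have h2 := hf ⟨w, hw⟩ y hy
    have h3 : f ⟨w, hw⟩ x = f ⟨w, hw⟩ y := congrArg Subtype.val (congrFun hxy ⟨w, hw⟩)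
    rw [h3] at h1
    rw [← sub_sub_sub_cancel_right x y]
    exact w.1.val.map_sub_lt h1 h2
  by_contra hne
  have hxy0 : x - y ≠ 0 := fun h => hne (Subtype.ext (sub_eq_zero.1 h))
  have hsum := hV.sum_formula _ hxy0
  have hord : (fun w : V => d w * (w.1.ord (x - y) : ℝ)).support.Finite :=
    (hV.finite_support _ hxy0).subset fun w hw h0 => hw (by simp [h0])
  have hexc := finite_support_excess hV m (x - y)
  have hterm : ∀ w : V, w.1.val (x - y) ≠ 0 := fun w => (Valuation.ne_zero_iff _).2 hxy0
  have hnonneg : ∀ w : V, 0 ≤ d w * (excess w.1.val (m w) (x - y) : ℝ) +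
      d w * (w.1.ord (x - y) : ℝ) := fun w => by
    rw [← mul_add]
    refine mul_nonneg (hV.deg_pos w).le ?_
    have : 0 ≤ excess w.1.val (m w) (x - y) + w.1.ord (x - y) := by
      rw [DiscVal.ord]
      by_cases hw : m w = 0
      · unfold excess
        split_ifs with h <;> omega
      · have h1 := excess_nonneg w.1.val (m w) (x - y)
        have h2 : log (w.1.val (x - y)) < 0 := by
          rw [log_lt_iff_lt_exp (hterm w), exp_zero]
          exact hclose w hw
        omega
    exact_mod_cast this
  have h₀ : d w₀ ≤ d w₀ * (excess w₀.1.val (m w₀) (x - y) : ℝ) +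
      d w₀ * (w₀.1.ord (x - y) : ℝ) := by
    have h1 := excess_nonneg w₀.1.val (m w₀) (x - y)
    have h2 : log (w₀.1.val (x - y)) < 0 := by
      rw [log_lt_iff_lt_exp (hterm w₀), exp_zero]
      exact hclose w₀ hw₀
    have h3 : (1 : ℝ) ≤ excess w₀.1.val (m w₀) (x - y) + (w₀.1.ord (x - y) : ℝ) := by
      rw [DiscVal.ord]
      exact_mod_cast (by omega : (1 : ℤ) ≤ excess w₀.1.val (m w₀) (x - y) +
        -log (w₀.1.val (x - y)))
    rw [← mul_add]
    exact le_mul_of_one_le_right (hV.deg_pos w₀).le h3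
  have h₁ := le_finsum_of_finite ((hexc.union hord).subset (Function.support_add _ _)) hnonneg w₀
  have h₂ := finsum_add_distrib hexc hord
  rw [hsum, add_zero] at h₂
  exact absurd (h₀.trans (h₁.trans_eq h₂)) (not_le.2 hz)

end GlobalHeight

open IsDedekindDomain

/-! ### Constants of an extension of a good set -/

namespace DiscVal

variable {K L : Type*} [Field K] [Field L] [Algebra K L]

lemma isDiscreteValuationRing (v : DiscVal K) :
    IsDiscreteValuationRing v.val.valuationSubring := by
  have : v.val.IsNontrivial := by
    obtain ⟨x, hx⟩ := v.surj (exp 1)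
    refine ⟨x, by rw [hx]; exact exp_ne_zero, ?_⟩
    rw [hx, Ne, exp_eq_one]
    exact one_ne_zero
  infer_instance

/-- An element of a finite separable extension that is integral at all extensions of `v` is integral
over the valuation ring of `v`: the primes of the integral closure of that ring, a Dedekind domain,
are extensions of `v`. -/
lemma isIntegral_of_forall_liesOver [FiniteDimensional K L] [Algebra.IsSeparable K L]
    (v : DiscVal K) {x : L} (h : ∀ w : DiscVal L, w.LiesOver v → w.val x ≤ 1) :
    IsIntegral v.val.valuationSubring x := by
  let O := v.val.valuationSubring
  have := v.isDiscreteValuationRing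
  let B := integralClosure O L
  have : IsDedekindDomain B := integralClosure.isDedekindDomain O K L
  have : IsFractionRing B L := integralClosure.isFractionRing_of_finite_extension K L
  obtain ⟨y, hy⟩ := HeightOneSpectrum.mem_integers_of_valuation_le_one (R := B) L x fun P => by
    have hle : ∀ a : O, P.valuation L (algebraMap K L a) ≤ 1 := fun a => by
      have := P.valuation_le_one (K := L) (algebraMap O B a)
      exact this
    have hmax : P.asIdeal.comap (algebraMap O B) = IsLocalRing.maximalIdeal O := by
      have := P.isMaximal
      have := Ideal.isMaximal_comap_of_isIntegral_of_isMaximal (R := O) P.asIdeal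
      exact IsLocalRing.eq_maximalIdeal this
    have hlt : ∀ a : O, v.val a < 1 → P.valuation L (algebraMap K L a) < 1 := fun a ha => by
      have h1 : algebraMap O B a ∈ P.asIdeal := by
        rw [← Ideal.mem_comap, hmax]
        exact (Valuation.mem_maximalIdeal_iff K v.val).2 ha
      have := (P.valuation_lt_one_iff_mem (K := L) (algebraMap O B a)).2 h1
      exact this
    refine h ⟨P.valuation L, P.valuation_surjective L⟩ ⟨?_⟩
    rw [Valuation.isEquiv_iff_val_le_one]
    intro a
    refine ⟨fun ha => hle ⟨a, ha⟩, fun ha => ?_⟩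
    by_contra! hlt'
    have ha0 : a ≠ 0 := by
      rintro rfl
      simp at hlt'
    have hinv : v.val a⁻¹ < 1 := by
      rw [map_inv₀]
      exact inv_lt_one_of_one_lt₀ hlt'
    have h2 := hlt ⟨a⁻¹, hinv.le⟩ hinv
    simp only [map_inv₀] at h2
    have h3 : (0 : ℤᵐ⁰) < P.valuation L (algebraMap K L a) := zero_lt_iff.2 (by simpa using ha0)
    exact absurd ((inv_lt_one₀ h3).1 h2) (not_lt.2 ha)
  rw [← hy]
  exact (integralClosure.isIntegral y).algebraMap

end DiscVal

/-- Constants of a finite separable extension are algebraic over the constants of the base. -/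
theorem IsGoodSet.isAlgebraic_constants {K L : Type*} [Field K] [Field L] [Algebra K L]
    [FiniteDimensional K L] [Algebra.IsSeparable K L] {U : Set (DiscVal K)} {d : U → ℝ}
    (hU : IsGoodSet U d) {x : L} (hx : ∀ w ∈ extensionSet U L, w.val x ≤ 1) :
    IsAlgebraic hU.constants x := by
  have hcoeff : ∀ i, (minpoly K x).coeff i ∈ hU.constants := fun i => by
    by_cases h0 : (minpoly K x).coeff i = 0
    · rw [h0]
      exact zero_mem _
    · refine Or.inr (hU.eq_one_of_le_one h0 fun v hv => ?_)
      have := v.isDiscreteValuationRing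
      have hint := v.isIntegral_of_forall_liesOver fun w hw => hx w ⟨v, hv, hw⟩
      rw [minpoly.isIntegrallyClosed_eq_field_fractions' K hint, Polynomial.coeff_map]
      exact ((minpoly v.val.valuationSubring x).coeff i).2
  have hlift : minpoly K x ∈ Polynomial.lifts (algebraMap hU.constants K) := by
    rw [Polynomial.lifts_iff_coeff_lifts]
    exact fun i => ⟨⟨_, hcoeff i⟩, rfl⟩
  obtain ⟨f, hf⟩ := hlift
  have hf' : f.map (algebraMap hU.constants K) = minpoly K x := hf
  have hint : IsIntegral K x := Algebra.IsIntegral.isIntegral x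
  refine ⟨f, fun h0 => minpoly.ne_zero hint ?_, ?_⟩
  · rw [← hf', h0, Polynomial.map_zero]
  · rw [← Polynomial.aeval_map_algebraMap K, hf', minpoly.aeval]

/-! ### Coefficients of twisted polynomials -/

open Finset.HasAntidiagonal (antidiagonal mem_antidiagonal)

namespace TwistedPoly

variable {Fq K : Type*} [Field Fq] [Finite Fq] [Field K] [Algebra Fq K]

lemma coeff_zero' (n : ℕ) : (0 : TwistedPoly Fq K).coeff n = 0 := rfl

lemma coeff_add (f g : TwistedPoly Fq K) (n : ℕ) : (f + g).coeff n = f.coeff n + g.coeff n :=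
  congrArg (fun h => h (Multiplicative.ofAdd n))
    (SkewMonoidAlgebra.coeff_add (k := K) (G := Multiplicative ℕ) f g)

lemma coeff_monomial (m n : ℕ) (c : K) :
    (monomial m c : TwistedPoly Fq K).coeff n = if m = n then c else 0 :=
  SkewPolynomial.coeff_monomial

lemma coeff_const (n : ℕ) (c : K) :
    (const c : TwistedPoly Fq K).coeff n = if n = 0 then c else 0 :=
  SkewPolynomial.coeff_C

lemma ext_coeff {f g : TwistedPoly Fq K} (h : ∀ n, f.coeff n = g.coeff n) : f = g :=
  SkewPolynomial.ext h

lemma exists_eval_eq_sum (f : TwistedPoly Fq K) : ∃ N, (∀ n ≥ N, f.coeff n = 0) ∧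
    ∀ x, f.eval x = ∑ i ∈ Finset.range N, f.coeff i * x ^ (Nat.card Fq ^ i) := by
  induction f using TwistedPoly.induction with
  | h0 => exact ⟨0, fun n _ => rfl, fun x => by simp [eval_zero]⟩
  | ha m c g hg =>
    obtain ⟨N, hN, heval⟩ := hg
    refine ⟨max N (m + 1), fun n hn => ?_, fun x => ?_⟩
    · rw [coeff_add, coeff_monomial, if_neg (by omega), hN n (by omega), add_zero]
    · rw [eval_add, eval_monomial, heval, Finset.sum_subset
        (Finset.range_subset_range.2 (le_max_left N (m + 1)))
        (fun i _ hi => by rw [hN i (by simpa using hi), zero_mul])]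
      simp only [coeff_add, add_mul, Finset.sum_add_distrib, coeff_monomial, ite_mul, zero_mul,
        Finset.sum_ite_eq]
      rw [if_pos (by simp)]

lemma eval_eq_sum {f : TwistedPoly Fq K} {D : ℕ} (hD : ∀ n > D, f.coeff n = 0) (x : K) :
    f.eval x = ∑ i ∈ Finset.range (D + 1), f.coeff i * x ^ (Nat.card Fq ^ i) := by
  obtain ⟨N, hN, heval⟩ := f.exists_eval_eq_sum
  rw [heval, Finset.sum_subset (Finset.range_subset_range.2 (le_max_left N (D + 1)))
    (fun i _ hi => by rw [hN i (by simpa using hi), zero_mul]),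
    ← Finset.sum_subset (Finset.range_subset_range.2 (le_max_right N (D + 1)))
    (fun i _ hi => by rw [hD i (by simp at hi; omega), zero_mul])]

lemma coeff_mul (f g : TwistedPoly Fq K) (n : ℕ) : (f * g).coeff n =
    ∑ a ∈ antidiagonal n, f.coeff a.1 * g.coeff a.2 ^ (Nat.card Fq ^ a.1) := by
  have hne : ∀ i, Nat.card Fq ^ i ≠ 0 := fun i => pow_ne_zero _ Nat.card_pos.ne'
  induction f using TwistedPoly.induction with
  | h0 => simp [coeff_zero']
  | ha m c f hf =>
    rw [add_mul, coeff_add, hf]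
    simp only [coeff_add (monomial m c), add_mul, Finset.sum_add_distrib]
    congr 1
    clear hf
    induction g using TwistedPoly.induction with
    | h0 => simp [coeff_zero', zero_pow (hne _)]
    | ha k b g hg =>
      rw [mul_add, coeff_add, hg]
      simp only [coeff_add (monomial k b), frob_add, mul_add, Finset.sum_add_distrib]
      congr 1
      rw [monomial_mul_monomial, coeff_monomial]
      simp only [coeff_monomial]
      split_ifs with hmk
      · rw [Finset.sum_eq_single (m, k)]
        · simp
        · rintro ⟨i, j⟩ - hij
          by_cases hi : m = i
          · have hj : k ≠ j := fun hj => hij (by rw [hi, hj])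
            simp only [if_neg hj, zero_pow (hne _), mul_zero]
          · rw [if_neg hi, zero_mul]
        · intro h
          exact absurd (mem_antidiagonal.2 hmk) h
      · refine (Finset.sum_eq_zero fun a ha => ?_).symm
        have := mem_antidiagonal.1 ha
        by_cases hi : m = a.1
        · have hj : k ≠ a.2 := by omega
          rw [if_neg hj, zero_pow (hne _), mul_zero]
        · rw [if_neg hi, zero_mul]

/-- The coefficient of `τ ^ n` in the conjugate `γ⁻¹ f γ`. -/
noncomputable def conjCoeff {Ω : Type*} [Field Ω] [Algebra K Ω] (γ : Ω) (f : TwistedPoly Fq K)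
    (n : ℕ) : Ω :=
  γ⁻¹ * algebraMap K Ω (f.coeff n) * γ ^ (Nat.card Fq ^ n)

lemma conjCoeff_mul {Ω : Type*} [Field Ω] [Algebra K Ω] {γ : Ω} (hγ : γ ≠ 0)
    (f g : TwistedPoly Fq K) (n : ℕ) : conjCoeff γ (f * g) n =
      ∑ a ∈ antidiagonal n, conjCoeff γ f a.1 * conjCoeff γ g a.2 ^ (Nat.card Fq ^ a.1) := by
  simp only [conjCoeff, coeff_mul, map_sum, Finset.mul_sum, Finset.sum_mul, map_mul, map_pow]
  refine Finset.sum_congr rfl fun a ha => ?_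
  rw [← mem_antidiagonal.1 ha, mul_pow, mul_pow, ← pow_mul γ, ← pow_add, inv_pow]
  have := pow_ne_zero (Nat.card Fq ^ a.1) hγ
  rw [show a.2 + a.1 = a.1 + a.2 from add_comm _ _]
  field_simp

/-- Every nonzero twisted polynomial has a degree. -/
lemma exists_degree {f : TwistedPoly Fq K} {n : ℕ} (hn : f.coeff n ≠ 0) :
    ∃ D ≥ n, f.coeff D ≠ 0 ∧ ∀ i > D, f.coeff i = 0 := by
  obtain ⟨N, hN, -⟩ := f.exists_eval_eq_sum
  classical
  have hnN : n ≤ N := by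
    by_contra! h
    exact hn (hN n h.le)
  refine ⟨Nat.findGreatest (fun i => f.coeff i ≠ 0) N, Nat.le_findGreatest hnN hn,
    Nat.findGreatest_spec (P := fun i => f.coeff i ≠ 0) hnN hn, fun i hi => ?_⟩
  by_contra h
  rcases le_or_gt i N with hiN | hiN
  · exact Nat.findGreatest_is_greatest hi hiN h
  · exact h (hN i hiN.le)

lemma coeff_mul_degree {f g : TwistedPoly Fq K} {m n : ℕ} (hf : ∀ i > m, f.coeff i = 0)
    (hg : ∀ i > n, g.coeff i = 0) :
    (f * g).coeff (m + n) = f.coeff m * g.coeff n ^ (Nat.card Fq ^ m) ∧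
      ∀ i > m + n, (f * g).coeff i = 0 := by
  have hne : ∀ i, Nat.card Fq ^ i ≠ 0 := fun i => pow_ne_zero _ Nat.card_pos.ne'
  constructor
  · rw [coeff_mul, Finset.sum_eq_single (m, n)]
    · rintro ⟨i, j⟩ hij hne'
      rw [mem_antidiagonal] at hij
      dsimp only at hij ⊢
      rcases lt_trichotomy i m with h | h | h
      · rw [hg j (by omega), zero_pow (hne _), mul_zero]
      · exact absurd (by rw [h, show j = n by omega]) hne'
      · rw [hf i h, zero_mul]
    · simp
  · intro k hk
    rw [coeff_mul]
    refine Finset.sum_eq_zero fun a ha => ?_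
    have := mem_antidiagonal.1 ha
    by_cases h : m < a.1
    · rw [hf _ h, zero_mul]
    · rw [hg a.2 (by omega), zero_pow (hne _), mul_zero]

end TwistedPoly

/-- If the sequences `b`, with last term `b_D = 1`, and `c` are the coefficients of commuting
twisted polynomials and all `b_n` are algebraic over `F`, then so are all `c_n`: comparing
coefficients of degree `n + D` expresses `c_n ^ (q ^ D) - c_n` through the `b_i` and the `c_j` with
`j > n`. -/
lemma isAlgebraic_of_commute {F Ω : Type*} [Field F] [Field Ω] [Algebra F Ω] {q D N : ℕ}
    (hq : 2 ≤ q) (hD : 1 ≤ D) {b c : ℕ → Ω} (hbalg : ∀ n, IsAlgebraic F (b n)) (hbD : b D = 1)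
    (hb : ∀ n > D, b n = 0) (hc : ∀ n > N, c n = 0)
    (hcomm : ∀ n, ∑ a ∈ antidiagonal n, b a.1 * c a.2 ^ q ^ a.1 =
      ∑ a ∈ antidiagonal n, c a.1 * b a.2 ^ q ^ a.1) (n : ℕ) : IsAlgebraic F (c n) := by
  have hne : ∀ i, q ^ i ≠ 0 := fun i => pow_ne_zero _ (by omega)
  let S := algebraicClosure F Ω
  have hbS : ∀ n, b n ∈ S := fun n => mem_algebraicClosure_iff.2 (hbalg n)
  suffices h : ∀ k n, N < n + k → c n ∈ S from
    mem_algebraicClosure_iff.1 (h (N + 1) n (by omega))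
  intro k
  induction k with
  | zero =>
    intro n hn
    rw [hc n (by omega)]
    exact zero_mem S
  | succ k ih =>
    intro n hn
    have hgt : ∀ m > n, c m ∈ S := fun m hm => ih m (by omega)
    have heq := hcomm (n + D)
    have hmem1 : (D, n) ∈ antidiagonal (n + D) := by simp [add_comm]
    have hmem2 : (n, D) ∈ antidiagonal (n + D) := by simp
    rw [← Finset.add_sum_erase _ _ hmem1, ← Finset.add_sum_erase _ _ hmem2, hbD] at heq
    have h1 : ∑ a ∈ (antidiagonal (n + D)).erase (D, n), b a.1 * c a.2 ^ q ^ a.1 ∈ S := by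
      refine sum_mem fun a ha => ?_
      rw [Finset.mem_erase, mem_antidiagonal] at ha
      rcases lt_trichotomy a.1 D with h | h | h
      · exact mul_mem (hbS _) (pow_mem (hgt _ (by omega)) _)
      · exact absurd (Prod.ext h (by dsimp only; omega)) ha.1
      · rw [hb _ h, zero_mul]
        exact zero_mem S
    have h2 : ∑ a ∈ (antidiagonal (n + D)).erase (n, D), c a.1 * b a.2 ^ q ^ a.1 ∈ S := by
      refine sum_mem fun a ha => ?_
      rw [Finset.mem_erase, mem_antidiagonal] at ha
      rcases lt_trichotomy a.1 n with h | h | h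
      · rw [hb a.2 (by omega), zero_pow (hne _), mul_zero]
        exact zero_mem S
      · exact absurd (Prod.ext h (by dsimp only; omega)) ha.1
      · exact mul_mem (hgt _ h) (pow_mem (hbS _) _)
    simp only [one_mul, one_pow, mul_one] at heq
    have hs : c n ^ q ^ D - c n ∈ S := by
      have := sub_mem h2 h1
      rwa [show c n ^ q ^ D - c n = _ - _ from
        sub_eq_sub_iff_add_eq_add.2 (heq.trans (add_comm _ _))]
    -- `c n` is a root of `X ^ (q ^ D) - X - s` with `s` algebraic.
    have hint : IsIntegral S (c n) := by
      open Polynomial in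
      refine ⟨X ^ q ^ D - (X + C ⟨_, hs⟩), monic_X_pow_sub ?_, ?_⟩
      · rw [degree_X_add_C]
        exact_mod_cast lt_of_lt_of_le (by omega : 1 < q) (Nat.le_self_pow (by omega) q)
      · simp
    exact mem_algebraicClosure_iff'.2 (isIntegral_trans (c n) hint)

namespace DrinfeldModule

variable {Fq A K : Type*} [Field Fq] [Finite Fq] [CommRing A] [Algebra Fq A]
  [Field K] [Algebra Fq K] (φ : DrinfeldModule Fq A K)

/-- Some `φ_t` has degree at least `2`: the square of a nonconstant `φ_a`. -/
lemma exists_two_le_degree : ∃ (t : A) (D : ℕ), 2 ≤ D ∧ (φ.hom t).coeff D ≠ 0 ∧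
    ∀ i > D, (φ.hom t).coeff i = 0 := by
  obtain ⟨a, ha⟩ := φ.nontrivial
  obtain ⟨n, hn0, hn⟩ : ∃ n, n ≠ 0 ∧ (φ.hom a).coeff n ≠ 0 := by
    by_contra! h
    refine ha (TwistedPoly.ext_coeff fun n => ?_)
    rw [TwistedPoly.coeff_const]
    split_ifs with h0
    · rw [h0, φ.coeff_zero]
    · exact h n h0
  obtain ⟨D, hD, hlead, hdeg⟩ := TwistedPoly.exists_degree hn
  obtain ⟨h1, h2⟩ := TwistedPoly.coeff_mul_degree hdeg hdeg
  refine ⟨a * a, D + D, by omega, ?_, ?_⟩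
  · rw [map_mul, h1]
    exact mul_ne_zero hlead (pow_ne_zero _ hlead)
  · rwa [map_mul]

/-- The field `Fq` acts on the points through its given action on `K`: as a unit of the ring of
twisted polynomials, `φ_c` is constant. -/
lemma eval_algebraMap (c : Fq) (x : K) :
    (φ.hom (algebraMap Fq A c)).eval x = algebraMap Fq K c * x := by
  rcases eq_or_ne c 0 with rfl | hc
  · rw [map_zero, map_zero, map_zero, TwistedPoly.eval_zero, zero_mul]
  have hcoeff : (φ.hom (algebraMap Fq A c)).coeff 0 = algebraMap Fq K c := by
    rw [φ.coeff_zero, AlgHom.commutes]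
  have hcoeff' : (φ.hom (algebraMap Fq A c⁻¹)).coeff 0 = algebraMap Fq K c⁻¹ := by
    rw [φ.coeff_zero, AlgHom.commutes]
  obtain ⟨m, -, hm, hm'⟩ := TwistedPoly.exists_degree (f := φ.hom (algebraMap Fq A c)) (n := 0)
    (by rw [hcoeff]; simpa using hc)
  obtain ⟨n, -, hn, hn'⟩ := TwistedPoly.exists_degree (f := φ.hom (algebraMap Fq A c⁻¹)) (n := 0)
    (by rw [hcoeff']; simpa using hc)
  have h1 := (TwistedPoly.coeff_mul_degree hm' hn').1
  have hone : φ.hom (algebraMap Fq A c) * φ.hom (algebraMap Fq A c⁻¹) = TwistedPoly.const 1 := by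
    rw [← map_mul, ← map_mul, mul_inv_cancel₀ hc, map_one, map_one]
    rfl
  have hmn : m = 0 := by
    by_contra hm0
    rw [hone, TwistedPoly.coeff_const, if_neg (by omega)] at h1
    exact mul_ne_zero hm (pow_ne_zero _ hn) h1.symm
  subst hmn
  rw [TwistedPoly.eval_eq_sum hm']
  simp [hcoeff]

/-- If `φ_t` has degree `D ≥ 1` and a conjugate of `φ` makes it monic with coefficients algebraic
over `F`, then the relative modular transcendence degree of `φ` over `F` vanishes. -/
lemma relModularTrdeg_eq_zero {F : Subfield K} {t : A} {D : ℕ} (hD : 1 ≤ D)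
    (hdeg : ∀ i > D, (φ.hom t).coeff i = 0) {γ : AlgebraicClosure K} (hγ : γ ≠ 0)
    (hmonic : TwistedPoly.conjCoeff γ (φ.hom t) D = 1)
    (halg : ∀ n, IsAlgebraic F (TwistedPoly.conjCoeff γ (φ.hom t) n)) :
    φ.relModularTrdeg F = 0 := by
  have hall : ∀ a n, IsAlgebraic F (TwistedPoly.conjCoeff γ (φ.hom a) n) := fun a => by
    obtain ⟨N, hN, -⟩ := (φ.hom a).exists_eval_eq_sum
    refine isAlgebraic_of_commute (q := Nat.card Fq) (D := D) (N := N) Finite.one_lt_card hD halg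
      hmonic (fun n hn => ?_) (fun n hn => ?_) fun n => ?_
    · simp [TwistedPoly.conjCoeff, hdeg n hn]
    · simp [TwistedPoly.conjCoeff, hN n hn.le]
    · rw [← TwistedPoly.conjCoeff_mul hγ, ← TwistedPoly.conjCoeff_mul hγ, ← map_mul, ← map_mul,
        mul_comm]
  have hle : IntermediateField.adjoin F (φ.conjFieldOfDefinition γ : Set (AlgebraicClosure K)) ≤
      algebraicClosure F (AlgebraicClosure K) := by
    rw [IntermediateField.adjoin_le_iff]
    have : φ.conjFieldOfDefinition γ ≤ (algebraicClosure F (AlgebraicClosure K)).toSubfield := by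
      refine Subfield.closure_le.2 ?_
      rintro _ ⟨a, n, rfl⟩
      exact mem_algebraicClosure_iff.2 (hall a n)
    exact this
  have hzero : Algebra.trdeg F (IntermediateField.adjoin F
      (φ.conjFieldOfDefinition γ : Set (AlgebraicClosure K))) = 0 := by
    have : Algebra.IsAlgebraic F (IntermediateField.adjoin F
        (φ.conjFieldOfDefinition γ : Set (AlgebraicClosure K))) :=
      ⟨fun x => (isAlgebraic_algebraMap_iff (Subtype.val_injective :
        Function.Injective (algebraMap _ (AlgebraicClosure K)))).1
        (mem_algebraicClosure_iff.1 (hle x.2))⟩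
    exact trdeg_eq_zero
  refine le_antisymm ?_ zero_le
  rw [← hzero]
  exact ciInf_le' _ (⟨γ, hγ⟩ : {γ : AlgebraicClosure K // γ ≠ 0})

end DrinfeldModule

/-! ### The height on a Drinfeld module of positive relative modular transcendence degree -/

section CoeffBound

variable {L : Type*} [Field L] (w : Valuation L ℤᵐ⁰) (D : ℕ) (b : ℕ → L)

/-- The largest pole order at `w` among the coefficients `b_i`, `i < D`, or `0` if these are all
integral. -/
def coeffBound : ℕ := (Finset.range D).sup fun i => (log (w (b i))).toNat

lemma le_exp_coeffBound {i : ℕ} (hi : i < D) : w (b i) ≤ exp (coeffBound w D b : ℤ) := by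
  refine le_exp_of_log_le ((Int.self_le_toNat _).trans ?_)
  exact_mod_cast Finset.le_sup (f := fun i => (log (w (b i))).toNat) (Finset.mem_range.2 hi)

lemma coeffBound_ne_zero_iff : coeffBound w D b ≠ 0 ↔ ∃ i < D, 1 < w (b i) := by
  have hpos : ∀ i, 0 < (log (w (b i))).toNat ↔ 1 < w (b i) := fun i => by
    rw [Int.lt_toNat, lt_log_iff w 0, Nat.cast_zero, exp_zero]
  rw [← Nat.pos_iff_ne_zero, coeffBound, Finset.lt_sup_iff]
  simp only [hpos, Finset.mem_range]

lemma finite_coeffBound_ne_zero {V : Set (DiscVal L)} {d : V → ℝ} (hV : IsGoodSet V d) :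
    {w : V | coeffBound w.1.val D b ≠ 0}.Finite := by
  refine ((Set.finite_lt_nat D).biUnion fun i _ => ?_ :
    (⋃ i ∈ {i | i < D}, {w : V | 1 < w.1.val (b i)}).Finite).subset fun w hw => ?_
  · by_cases h0 : b i = 0
    · simp [h0]
    · refine (hV.finite_support _ h0).subset fun w hw => ?_
      have : (0 : ℤ) < log (w.1.val (b i)) := by
        rw [← Nat.cast_zero, lt_log_iff, Nat.cast_zero, exp_zero]
        exact hw
      change w.1.ord (b i) ≠ 0
      rw [DiscVal.ord]
      omega
  · obtain ⟨i, hi, hw⟩ := (coeffBound_ne_zero_iff w.1.val D b).1 hw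
    exact Set.mem_biUnion (show i ∈ {i | i < D} from hi) hw

end CoeffBound

/-- The additive map `y ↦ ∑ bᵢ y ^ (q ^ i)` (`i ≤ D`), where `q` is the cardinality of `Fq`. -/
noncomputable def additiveMap (Fq : Type*) {L : Type*} [Field Fq] [Finite Fq] [Field L]
    [Algebra Fq L] (D : ℕ) (b : ℕ → L) : L →+ L where
  toFun y := ∑ i ∈ Finset.range (D + 1), b i * y ^ (Nat.card Fq ^ i)
  map_zero' := Finset.sum_eq_zero fun i _ => by
    rw [zero_pow (pow_ne_zero _ Nat.card_pos.ne'), mul_zero]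
  map_add' x y := by simp only [TwistedPoly.frob_add, mul_add, Finset.sum_add_distrib]

lemma additiveMap_apply {Fq L : Type*} [Field Fq] [Finite Fq] [Field L] [Algebra Fq L] (D : ℕ)
    (b : ℕ → L) (y : L) :
    additiveMap Fq D b y = ∑ i ∈ Finset.range (D + 1), b i * y ^ (Nat.card Fq ^ i) := rfl

lemma algebraMap_pow_card_pow {Fq L : Type*} [Field Fq] [Finite Fq] [Field L] [Algebra Fq L]
    (c : Fq) (i : ℕ) : algebraMap Fq L c ^ (Nat.card Fq ^ i) = algebraMap Fq L c := by
  have := Fintype.ofFinite Fq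
  rw [← map_pow, Nat.card_eq_fintype_card, FiniteField.pow_card_pow]

lemma isMonicAdditive_additiveMap {Fq L : Type*} [Field Fq] [Finite Fq] [Field L] [Algebra Fq L]
    {D : ℕ} {b : ℕ → L} (hD : 1 ≤ D) (hb : b D = 1) :
    IsMonicAdditive (Nat.card Fq) D b (additiveMap Fq D b) :=
  ⟨Finite.one_lt_card, hD, hb, additiveMap_apply D b⟩

namespace IsMonicAdditive

/-- The cokernel of a monic additive polynomial on a discretely valued field is infinite: values of
`T` with a large pole have pole order divisible by `q ^ D`. -/
lemma not_exists_finite_coset {L : Type*} [Field L] {q D : ℕ} {b : ℕ → L} {T : L →+ L}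
    (hT : IsMonicAdditive q D b T) (w : DiscVal L) {R : Set L} (hR : R.Finite) :
    ¬ ∀ z, ∃ r ∈ R, ∃ y, z = r + T y := by
  intro h
  have hQ := hT.two_le_pow
  set m := coeffBound w.val D b
  have hb : ∀ i < D, w.val (b i) ≤ exp (m : ℤ) := fun i hi => le_exp_coeffBound _ _ _ hi
  -- If `z j` and `z k` are congruent modulo the image of `T`, then the image contains their
  -- difference, whose pole order is large and congruent to `1` modulo `q ^ D`.
  choose z hz using fun j : ℕ => w.surj (exp ((q ^ D * (m + j) + 1 : ℕ) : ℤ))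
  choose r hr y hy using fun j => h (z j)
  have := hR.to_subtype
  obtain ⟨j, k, hjk, hrjk⟩ := Finite.exists_ne_map_eq_of_infinite fun j => (⟨r j, hr j⟩ : R)
  have key : ∀ j k, j < k → r j = r k → False := by
    intro j k hjk hrjk
    have h1 : z k - z j = T (y k - y j) := by
      rw [hy k, hy j, hrjk, map_sub]
      abel
    have hlt : w.val (z j) < w.val (z k) := by
      rw [hz, hz, exp_lt_exp]
      have : q ^ D * (m + j) < q ^ D * (m + k) := Nat.mul_lt_mul_of_pos_left (by omega) (by omega)
      exact_mod_cast Nat.succ_lt_succ this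
    have h2 := w.val.map_sub_eq_of_lt_left hlt
    rw [h1, hz] at h2
    rcases le_or_gt (w.val (y k - y j)) (exp (m : ℤ)) with hle | hgt
    · have h3 := hT.map_le w.val hb hle
      rw [h2, exp_le_exp] at h3
      have h4 : q ^ D * (m + k) + 1 ≤ q ^ D * m := by exact_mod_cast h3
      have h5 : q ^ D * m ≤ q ^ D * (m + k) := Nat.mul_le_mul_left _ (by omega)
      omega
    · rw [hT.map_eq_pow w.val hb hgt] at h2
      have h3 := congrArg log h2
      rw [log_pow, log_exp, nsmul_eq_mul] at h3
      have h4 : ((q ^ D : ℕ) : ℤ) ∣ 1 := by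
        refine (Int.dvd_add_right (a := ((q ^ D : ℕ) : ℤ))
          (b := ((q ^ D * (m + k) : ℕ) : ℤ)) ?_).1 ?_
        · exact_mod_cast Dvd.intro _ rfl
        · have h5 : ((q ^ D * (m + k) + 1 : ℕ) : ℤ) =
              ((q ^ D * (m + k) : ℕ) : ℤ) + 1 := by
            push_cast
            rfl
          rw [← h5, ← h3]
          exact Dvd.intro _ rfl
      have := Int.le_of_dvd one_pos h4
      omega
  have hrjk' : r j = r k := congrArg Subtype.val hrjk
  rcases lt_or_gt_of_ne hjk with hlt | hlt
  · exact key j k hlt hrjk'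
  · exact key k j hlt hrjk'.symm

end IsMonicAdditive

namespace DrinfeldModule

variable {Fq A K : Type*} [Field Fq] [Finite Fq] [CommRing A] [Algebra Fq A]
  [Field K] [Algebra Fq K] (φ : DrinfeldModule Fq A K)

/-- The canonical height with respect to `φ_t`. It is computed on `K(γ)`, where `γ` makes the
conjugate `γ⁻¹ φ_t γ` monic; positivity of the relative modular transcendence degree means that some
coefficient of this conjugate has a pole. -/
theorem exists_height {U : Set (DiscVal K)} {d : U → ℝ} (hU : IsCoherentGoodSet U d)
    (hφ : 0 < φ.relModularTrdeg hU.isGoodSet.constants) {t : A} {D : ℕ} (hD : 1 ≤ D)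
    (hlead : (φ.hom t).coeff D ≠ 0) (hdeg : ∀ i > D, (φ.hom t).coeff i = 0) :
    U.Nonempty ∧ ∃ (h : K → ℝ) (ε : ℝ), 0 < ε ∧ (∀ x, 0 ≤ h x) ∧
      (∀ x y, h (x + y) ≤ h x + h y) ∧ (∀ (c : Fq) x, h (algebraMap Fq K c * x) ≤ h x) ∧
      (∀ x, h ((φ.hom t).eval x) = (Nat.card Fq ^ D : ℕ) * h x) ∧ {x | h x < ε}.Finite := by
  set q := Nat.card Fq with hq
  have hq2 : 2 ≤ q := Finite.one_lt_card
  have hQ : 2 ≤ q ^ D := hq2.trans (Nat.le_self_pow (by omega) q)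
  obtain ⟨γ, hγ⟩ := IsAlgClosed.exists_pow_nat_eq
    (algebraMap K (AlgebraicClosure K) ((φ.hom t).coeff D)⁻¹) (n := q ^ D - 1) (by omega)
  have hγ0 : γ ≠ 0 := by
    rintro rfl
    rw [zero_pow (by omega)] at hγ
    exact inv_ne_zero hlead ((map_eq_zero _).1 hγ.symm)
  have hqK : (q : K) = 0 := by
    have := Fintype.ofFinite Fq
    rw [hq, Nat.card_eq_fintype_card, ← map_natCast (algebraMap Fq K),
      FiniteField.cast_card_eq_zero, map_zero]
  have hint : IsIntegral K γ := Algebra.IsIntegral.isIntegral γ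
  have hsep : IsSeparable K γ := by
    have h1 : (Polynomial.X ^ (q ^ D - 1) - Polynomial.C ((φ.hom t).coeff D)⁻¹ :
        Polynomial K).Separable := by
      refine Polynomial.separable_X_pow_sub_C _ ?_ (inv_ne_zero hlead)
      rw [Nat.cast_sub (by omega), Nat.cast_pow, hqK, zero_pow (by omega)]
      simp
    refine h1.of_dvd (minpoly.dvd K γ ?_)
    simp [hγ]
  let L := IntermediateField.adjoin K {γ}
  have hfd : FiniteDimensional K L := IntermediateField.adjoin.finiteDimensional hint
  have hsepL : Algebra.IsSeparable K L :=
    (IntermediateField.isSeparable_adjoin_simple_iff_isSeparable K _).2 hsep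
  let g : L := IntermediateField.AdjoinSimple.gen K γ
  have hgγ : algebraMap L (AlgebraicClosure K) g = γ := rfl
  have hg0 : g ≠ 0 := fun h0 => hγ0 (by rw [← hgγ, h0, map_zero])
  obtain ⟨dL, -, hV⟩ := hU.extension L hfd
  -- The coefficients of the conjugate `γ⁻¹ φ_t γ`.
  let b : ℕ → L := TwistedPoly.conjCoeff g (φ.hom t)
  have hbγ : ∀ n, algebraMap L (AlgebraicClosure K) (b n) =
      TwistedPoly.conjCoeff γ (φ.hom t) n := fun n => by
    simp only [b, TwistedPoly.conjCoeff, map_mul, map_inv₀, map_pow, hgγ]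
    rfl
  have hmonic : TwistedPoly.conjCoeff γ (φ.hom t) D = 1 := by
    have h1 : γ ^ q ^ D = γ * γ ^ (q ^ D - 1) := by
      rw [← pow_succ']
      congr 1
      omega
    rw [TwistedPoly.conjCoeff, h1, hγ, map_inv₀]
    have : algebraMap K (AlgebraicClosure K) ((φ.hom t).coeff D) ≠ 0 := by simpa using hlead
    field_simp
  have hbD : b D = 1 := by
    apply (algebraMap L (AlgebraicClosure K)).injective
    rw [hbγ, hmonic, map_one]
  let T := additiveMap Fq D b
  have hT : IsMonicAdditive q D b T := isMonicAdditive_additiveMap hD hbD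
  let m : extensionSet U L → ℕ := fun w => coeffBound w.1.val D b
  have hex : ∃ w, m w ≠ 0 := by
    by_contra! h
    refine hφ.ne' (φ.relModularTrdeg_eq_zero hD hdeg hγ0 hmonic fun n => ?_)
    rw [← hbγ]
    have hle : ∀ w ∈ extensionSet U L, w.val (b n) ≤ 1 := by
      intro w hw
      rcases lt_trichotomy n D with hn | rfl | hn
      · by_contra! hlt
        exact (coeffBound_ne_zero_iff w.val D b).2 ⟨n, hn, hlt⟩ (h ⟨w, hw⟩)
      · rw [hbD, map_one]
      · rw [show b n = 0 by simp [b, TwistedPoly.conjCoeff, hdeg n hn], map_zero]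
        exact zero_le
    obtain ⟨f, hf0, hf⟩ := hU.isGoodSet.isAlgebraic_constants hle
    refine ⟨f, hf0, ?_⟩
    have h1 := congrArg (algebraMap L (AlgebraicClosure K)) hf
    rw [map_zero, Polynomial.aeval_def, Polynomial.hom_eval₂] at h1
    exact h1
  refine ⟨?_, ?_⟩
  · obtain ⟨⟨w, v, hv, -⟩, -⟩ := hex
    exact ⟨v, hv⟩
  have hb : ∀ w : extensionSet U L, ∀ i < D, w.1.val (b i) ≤ exp (m w : ℤ) :=
    fun w i hi => le_exp_coeffBound _ _ _ hi
  have hm : {w | m w ≠ 0}.Finite := finite_coeffBound_ne_zero D b hV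
  have hbad : ∀ w, m w ≠ 0 → ∃ i < D, 1 < w.1.val (b i) := fun w hw =>
    (coeffBound_ne_zero_iff _ _ _).1 hw
  obtain ⟨ε, hε, hfin⟩ := exists_finite_canonicalHeight_lt hV m hT hb hm hbad hex
  -- The change of coordinates `x ↦ γ⁻¹ x` carries `φ_t` to `T`.
  let j : K → L := fun x => g⁻¹ * algebraMap K L x
  have hj : Function.Injective j := fun x y hxy =>
    (algebraMap K L).injective (mul_left_cancel₀ (inv_ne_zero hg0) hxy)
  have hTj : ∀ x, j ((φ.hom t).eval x) = T (j x) := fun x => by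
    change _ = additiveMap Fq D b _
    rw [additiveMap_apply, TwistedPoly.eval_eq_sum hdeg]
    simp only [j, map_sum, map_mul, map_pow, Finset.mul_sum]
    refine Finset.sum_congr rfl fun i _ => ?_
    simp only [b, TwistedPoly.conjCoeff, mul_pow, inv_pow]
    have := pow_ne_zero (Nat.card Fq ^ i) hg0
    field_simp
  refine ⟨fun x => canonicalHeight dL m (q ^ D) T (j x), ε, hε, fun x => ?_, fun x y => ?_,
    fun c x => ?_, fun x => ?_, hfin.preimage hj.injOn⟩
  · exact canonicalHeight_nonneg hV m hT hb hm _
  · dsimp only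
    rw [show j (x + y) = j x + j y by simp only [j, map_add, mul_add]]
    exact canonicalHeight_add_le hV m hT hb hm (j x) (j y)
  · have h1 : j (algebraMap Fq K c * x) = algebraMap Fq L c * j x := by
      simp only [j, map_mul]
      rw [← IsScalarTower.algebraMap_apply Fq K L]
      ring
    dsimp only
    rw [h1]
    rcases eq_or_ne c 0 with rfl | hc
    · have h0 := canonicalHeight_map hV m hT hb hm 0
      rw [map_zero] at h0
      have hQ' : (2 : ℝ) ≤ (q ^ D : ℕ) := by exact_mod_cast hQ
      have hx := canonicalHeight_nonneg hV m hT hb hm (j x)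
      rw [map_zero, zero_mul]
      nlinarith [canonicalHeight_nonneg hV m hT hb hm 0]
    · rw [canonicalHeight_mul]
      · exact fun w => FiniteField.valuation_algebraMap_eq_one w.1.val c hc
      · intro y
        change additiveMap Fq D b _ = _ * additiveMap Fq D b _
        simp only [additiveMap_apply, mul_pow, algebraMap_pow_card_pow, Finset.mul_sum]
        exact Finset.sum_congr rfl fun i _ => by ring
  · dsimp only
    rw [hTj]
    exact canonicalHeight_map hV m hT hb hm _

end DrinfeldModule

/-! ### The structure of the module of points -/

/-- The ring of functions regular away from `∞` is integrally closed, as an intersection of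
valuation rings. -/
lemma isIntegrallyClosed_regularFunctions (Fq : Type*) {E : Type*} [Field Fq] [Finite Fq] [Field E]
    [Algebra Fq E] (infty : DiscVal E) : IsIntegrallyClosed (regularFunctions Fq infty) := by
  have : IsIntegrallyClosedIn (regularFunctions Fq infty) E := by
    rw [isIntegrallyClosedIn_iff]
    refine ⟨Subtype.val_injective, fun {x} hx => ⟨⟨x, fun P hP => ?_⟩, rfl⟩⟩
    have hx' : IsIntegral P.val.integer x := by
      let j : regularFunctions Fq infty →+* P.val.integer :=
        { toFun := fun f => ⟨f, f.2 P hP⟩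
          map_one' := rfl
          map_mul' := fun _ _ => rfl
          map_zero' := rfl
          map_add' := fun _ _ => rfl }
      obtain ⟨f, hf, hfx⟩ := hx
      refine ⟨f.map j, hf.map j, ?_⟩
      rw [Polynomial.eval₂_map]
      exact hfx
    exact (Valuation.integer.integers P.val).mem_of_integral hx'
  exact IsIntegrallyClosed.of_isIntegrallyClosedIn _ E

namespace DrinfeldModule

open Polynomial

/-- A Drinfeld module over a field with a discrete valuation has infinitely many points modulo a
nonconstant `φ_t`. -/
lemma not_exists_finite_coset {Fq A K : Type*} [Field Fq] [Finite Fq] [CommRing A] [Algebra Fq A]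
    [Field K] [Algebra Fq K] (φ : DrinfeldModule Fq A K) (v : DiscVal K) {t : A} {D : ℕ}
    (hD : 1 ≤ D) (hlead : (φ.hom t).coeff D ≠ 0) (hdeg : ∀ i > D, (φ.hom t).coeff i = 0)
    {R : Set K} (hR : R.Finite) : ¬ ∀ x, ∃ r ∈ R, ∃ y, x = r + (φ.hom t).eval y := by
  intro h
  let b : ℕ → K := fun i => ((φ.hom t).coeff D)⁻¹ * (φ.hom t).coeff i
  have hT := isMonicAdditive_additiveMap (Fq := Fq) (b := b) hD (inv_mul_cancel₀ hlead)
  refine hT.not_exists_finite_coset v (hR.image fun r => ((φ.hom t).coeff D)⁻¹ * r) fun z => ?_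
  obtain ⟨r, hr, y, hy⟩ := h ((φ.hom t).coeff D * z)
  refine ⟨_, ⟨r, hr, rfl⟩, y, ?_⟩
  rw [← mul_right_inj' hlead, hy, mul_add, mul_inv_cancel_left₀ hlead, additiveMap_apply,
    TwistedPoly.eval_eq_sum hdeg, Finset.mul_sum]
  congr 1
  refine Finset.sum_congr rfl fun i _ => ?_
  simp only [b]
  rw [mul_assoc, mul_inv_cancel_left₀ hlead]

end DrinfeldModule

section Structure

open Polynomial

variable {k E A M : Type*} [Field k] [Field E] [Algebra k E] [CommRing A] [Algebra k A]
  [Algebra A E] [IsScalarTower k A E] [FaithfulSMul A E] [AddCommGroup M] [Module A M]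

/-- The structure theorem, for modules with a height: let `A` be an integrally closed ring of
functions of a curve over the finite field `k`, and let `M` be a countable `A`-module with a height
for the action of `k[t]`, `t ∈ A`, such that `M` has finitely many points of height `< ε`. If
`M / t M` is infinite, then `M` is the direct sum of its finite torsion submodule and a free
submodule of rank `ℵ₀`. -/
lemma exists_isCompl_torsion_of_height [Finite k] [IsIntegrallyClosed A] [Countable M]
    (hE_fg : (⊤ : IntermediateField k E).FG) (hE_trdeg : Algebra.trdeg k E = 1)
    (t : A) {h : M → ℝ} {Q ε : ℝ} (hQ : 3 ≤ Q) (hε : 0 < ε) (hnonneg : ∀ x, 0 ≤ h x)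
    (hadd : ∀ x y, h (x + y) ≤ h x + h y) (hconst : ∀ (c : k) x, h (algebraMap k A c • x) ≤ h x)
    (hmap : ∀ x, h (t • x) = Q * h x) (hfin : {x | h x < ε}.Finite)
    (hcoset : ∀ R : Set M, R.Finite → ¬ ∀ x, ∃ r ∈ R, ∃ y, x = r + t • y) :
    ∃ N : Submodule A M, IsCompl (torsion A M) N ∧ Finite (torsion A M) ∧
      Module.Free A N ∧ Module.rank A N = Cardinal.aleph0 := by
  have hAE : Function.Injective (algebraMap A E) := FaithfulSMul.algebraMap_injective A E
  have : IsDomain A := hAE.isDomain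
  let _ : Algebra k[X] A := (aeval t).toAlgebra
  let _ : Algebra k[X] E := (aeval (algebraMap A E t)).toAlgebra
  let _ : Module k[X] M := Module.compHom M (algebraMap k[X] A)
  have : IsScalarTower k[X] A M := ⟨fun p a x => by
    rw [Algebra.smul_def, mul_smul]
    rfl⟩
  have : IsScalarTower k[X] A E := IsScalarTower.of_algebraMap_eq fun p =>
    aeval_algebraMap_apply E t p
  have : IsScalarTower k k[X] E := IsScalarTower.of_algebraMap_eq fun c =>
    (aeval_C (algebraMap A E t) c).symm
  have hX : ∀ x : M, (X : k[X]) • x = t • x := fun x => by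
    change aeval t X • x = _
    rw [aeval_X]
  have hC : ∀ (c : k) (x : M), (C c : k[X]) • x = algebraMap k A c • x := fun c x => by
    change aeval t (C c) • x = _
    rw [aeval_C]
  have hh : IsHeight (k := k) h Q :=
    ⟨hnonneg, hadd, fun c x => (hC c x).symm ▸ hconst c x, fun x => (hX x).symm ▸ hmap x⟩
  have : Infinite M := by
    by_contra hM
    have := not_infinite_iff_finite.1 hM
    exact hcoset Set.univ Set.finite_univ fun x => ⟨x, trivial, 0, by simp⟩
  obtain ⟨x₀, hx₀⟩ : ∃ x₀ : M, ¬ h x₀ < ε := hfin.exists_notMem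
  have hpos : 0 < h x₀ := hε.trans_le (not_lt.1 hx₀)
  have hzero : ∀ (p : k[X]) (x : M), p ≠ 0 → p • x = 0 → h x = 0 := fun p x hp hpx => by
    have h1 := hh.le_smul hQ hp x
    rw [hpx, hh.zero hQ] at h1
    have h2 : 0 < Q ^ p.natDegree / 2 := by positivity
    nlinarith [hnonneg x]
  have hinj : Function.Injective (algebraMap k[X] A) := by
    rw [injective_iff_map_eq_zero]
    intro p hp
    by_contra hp0
    refine hpos.ne' (hzero p x₀ hp0 ?_)
    rw [← algebraMap_smul A p x₀, hp, zero_smul]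
  have : FaithfulSMul k[X] A := (faithfulSMul_iff_algebraMap_injective _ _).2 hinj
  have : FaithfulSMul k[X] E := (faithfulSMul_iff_algebraMap_injective _ _).2 (by
    rw [IsScalarTower.algebraMap_eq k[X] A E]
    exact hAE.comp hinj)
  obtain ⟨halgE, hrankE⟩ := isAlgebraic_and_rank_lt_aleph0 hE_fg hE_trdeg
  have : Algebra.IsAlgebraic k[X] A :=
    ⟨fun a => (isAlgebraic_algebraMap_iff (A := E) hAE).1 (halgE.1 _)⟩
  have hrank : Module.rank k[X] A < Cardinal.aleph0 :=
    Cardinal.lift_lt_aleph0.1 ((LinearMap.lift_rank_le_of_injective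
      (IsScalarTower.toAlgHom k[X] A E).toLinearMap hAE).trans_lt
        (Cardinal.lift_lt_aleph0.2 hrankE))
  have htors : ∀ (a : A) (x : M), a ≠ 0 → a • x = 0 → h x = 0 := fun a x ha hax => by
    obtain ⟨r, hr, b, hb⟩ := (Algebra.IsAlgebraic.isAlgebraic (R := k[X]) a).exists_nonzero_dvd
      (mem_nonZeroDivisors_of_ne_zero ha)
    refine hzero r x hr ?_
    rw [← algebraMap_smul A r x, hb, mul_comm, mul_smul, hax, smul_zero]
  -- A non-torsion point `x₀` embeds `A` into a finitely generated hull.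
  have : Module.Finite k[X] A := hh.finite_of_torsion_free_point hQ hε hfin hrank
    (x := x₀) fun a ha => by
      by_contra ha0
      exact hpos.ne' (htors a x₀ ha0 ha)
  have : IsNoetherianRing A :=
    isNoetherian_of_tower k[X] (isNoetherian_of_isNoetherianRing_of_finite k[X] A)
  have : Algebra.IsIntegral k[X] A := Algebra.IsIntegral.of_finite k[X] A
  have : Ring.DimensionLEOne A := Ring.DimensionLEOne.of_isIntegral k[X] A
  have : IsDedekindDomain A := { }
  have hhulls : HasFGHulls A M := hh.hasFGHulls hQ hε hfin hrank
  -- Splitting off the constant terms of the coefficients of a linear combination of generators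
  -- shows that `M / t M` is finite if `M` is finitely generated.
  have hnot : ¬ Module.Finite A M := by
    intro hfinA
    have hfinX : Module.Finite k[X] M := Module.Finite.trans A _
    obtain ⟨s, hs⟩ := hfinX.fg_top
    refine hcoset (Set.range fun c : s → k => ∑ i, (C (c i) : k[X]) • (i : M))
      (Set.finite_range _) fun x => ?_
    have hx : x ∈ span k[X] (s : Set M) := hs ▸ mem_top
    obtain ⟨f, hf⟩ := mem_span_finset'.1 hx
    refine ⟨_, ⟨fun i => (f i).coeff 0, rfl⟩, ∑ i, (f i).divX • (i : M), ?_⟩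
    rw [← hX, Finset.smul_sum, ← Finset.sum_add_distrib, ← hf]
    refine Finset.sum_congr rfl fun i _ => ?_
    rw [smul_smul, ← add_smul, add_comm, X_mul_divX_add]
  have hfinT : Finite (torsion A M) := by
    refine Set.Finite.subset hfin fun x hx => ?_
    obtain ⟨a, ha⟩ := (mem_torsion_iff x).1 hx
    exact (htors a x (nonZeroDivisors.ne_zero a.2) ha).trans_lt hε
  obtain ⟨N, hN, hfree, hrankN⟩ := hhulls.exists_isCompl_torsion hnot hfinT
  exact ⟨N, hN, hfinT, hfree, hrankN⟩

end Structure

theorem theoremT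
    {Fq : Type*} [Field Fq] [Finite Fq]
    -- the function field of a nonsingular projective curve over `Fq`, and a closed point of it
    {E : Type*} [Field E] [Algebra Fq E]
    (hE_fg : (⊤ : IntermediateField Fq E).FG) (hE_trdeg : Algebra.trdeg Fq E = 1)
    (infty : DiscVal E)
    (p : ℕ) [Fact p.Prime]
    {K : Type*} [Field K] [CharP K p] [Countable K] [Algebra Fq K]
    (U : Set (DiscVal K)) (d : U → ℝ) (hU : IsCoherentGoodSet U d)
    (φ : DrinfeldModule Fq (regularFunctions Fq infty) K)
    (hφ : 0 < φ.relModularTrdeg hU.isGoodSet.constants) :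
    ∃ N : Submodule (regularFunctions Fq infty) φ.Points,
      IsCompl (Submodule.torsion (regularFunctions Fq infty) φ.Points) N ∧
      Finite (Submodule.torsion (regularFunctions Fq infty) φ.Points) ∧
      Module.Free (regularFunctions Fq infty) N ∧
      Module.rank (regularFunctions Fq infty) N = Cardinal.aleph0 := by
  obtain ⟨t, D, hD, hlead, hdeg⟩ := φ.exists_two_le_degree
  obtain ⟨⟨v, -⟩, h, ε, hε, hnonneg, hadd, hconst, hmap, hfin⟩ :=
    φ.exists_height hU hφ (by omega) hlead hdeg
  -- A degree of at least `2` makes the height grow by a factor of at least `4`.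
  have hQ : (3 : ℝ) ≤ (Nat.card Fq ^ D : ℕ) := by
    have h2 : 2 ≤ Nat.card Fq := Finite.one_lt_card
    have h4 : 2 ^ 2 ≤ Nat.card Fq ^ D :=
      (Nat.pow_le_pow_left h2 2).trans (Nat.pow_le_pow_right (by omega) hD)
    exact_mod_cast (by omega : 3 ≤ Nat.card Fq ^ D)
  have := isIntegrallyClosed_regularFunctions Fq infty
  have : Countable φ.Points := inferInstanceAs (Countable K)
  exact exists_isCompl_torsion_of_height (M := φ.Points) hE_fg hE_trdeg t hQ hε hnonneg hadd
    (fun c x => (congrArg h (φ.eval_algebraMap c x)).trans_le (hconst c x)) hmap hfin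
    fun R hR => φ.not_exists_finite_coset v (by omega) hlead hdeg hR
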